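/- Let $m \ge 1$. A convex body $K \subset \mathbb{R}^m$ is a compact convex set with nonempty interior. A normal of $K$ at a boundary point $q$ is a line starting at $q$, running in the direction opposite to an outer unit normal vector of a supporting hyperplane of $K$ at $q$; normals with different starting points are counted as different. For $p \in K$ let $n(K,p)$ be the number of normals of $K$ passing through $p$, and let $$n(K) = \frac{1}{\operatorname{vol}(K)} \int_K n(K,p)\, dp .$$ Let $K \subset \mathbb{R}^m$ be a convex body with $C^2$-class boundary that contains all its centres of curvature, i.e. all points $q - \frac{1}{\kappa} u$, where $q$ is a boundary point of $K$, $u$ is the outer unit normal of $K$ at $q$ and $\kappa \neq 0$ is a principal curvature of the boundary at $q$. Let $T > 0$, and let $C : \mathbb{S}^{m-1} \times [0,T) \to \mathbb{R}^m$ be a (continuous) deformation of an embedding $C(\cdot,0)$ of the sphere onto the boundary of $K$, such that for every $t \in [0,T)$ the set $C(\mathbb{S}^{m-1},t)$ is the boundary of a convex body $K(t)$ (with $K(0)=K$) which has a unique outer unit normal $N$ at each boundary point, and $$\frac{\partial C}{\partial t} = N .$$ Then $n(K(t))$ is finite for every $t \in [0,T)$, and (i) if $K$ is not a Euclidean ball,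 then $n(K(t))$ is a strictly decreasing function of $t \in [0,T)$; (ii) if $K$ is a Euclidean ball, then $n(K(t)) = 2$ for every $t \in [0,T)$. -/

import Mathlib

open scoped ENNReal

noncomputable section

/-- A convex body: a compact convex set with nonempty interior. -/
def IsConvexBody {m : ℕ} (K : Set (EuclideanSpace ℝ (Fin m))) : Prop :=
  Convex ℝ K ∧ IsCompact K ∧ (interior K).Nonempty

/-- `u` is an outer unit normal vector of `K` at `q`: the hyperplane through `q` perpendicular to
the unit vector `u` bounds a closed half-space that contains `K`, and `u` points away from `K`. -/
def IsOuterUnitNormal {m : ℕ} (K : Set (EuclideanSpace ℝ (Fin m)))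
    (q u : EuclideanSpace ℝ (Fin m)) : Prop :=
  ‖u‖ = 1 ∧ ∀ x ∈ K, inner ℝ (x - q) u ≤ 0

/-- The number of normals of `K` that pass through `p`. A normal is a line that starts at a
boundary point `q` of `K` and runs into the direction `-u`, where `u` is an outer unit normal
vector at `q`; it is recorded as the pair `(q, u)`, so that a chord that is perpendicular to
supporting hyperplanes at both of its endpoints counts once for each endpoint. -/
def numNormals {m : ℕ} (K : Set (EuclideanSpace ℝ (Fin m)))
    (p : EuclideanSpace ℝ (Fin m)) : ℕ∞ :=
  Set.encard {ν : EuclideanSpace ℝ (Fin m) × EuclideanSpace ℝ (Fin m) |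
    ν.1 ∈ frontier K ∧ IsOuterUnitNormal K ν.1 ν.2 ∧ ∃ s : ℝ, 0 ≤ s ∧ p = ν.1 - s • ν.2}

/-- `I(K)`, the integral over `K` of the number of normals through a point. -/
def normalIntegral {m : ℕ} (K : Set (EuclideanSpace ℝ (Fin m))) : ℝ≥0∞ :=
  ∫⁻ p in K, (numNormals K p : ℝ≥0∞) ∂MeasureTheory.volume

/-- `n(K) = I(K) / vol(K)`, the average number of normals through a point of `K`. -/
def meanNormals {m : ℕ} (K : Set (EuclideanSpace ℝ (Fin m))) : ℝ≥0∞ :=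
  normalIntegral K / MeasureTheory.volume K

/-- The boundary of `K` is of class `C²`: near each boundary point, `K` is a sublevel set of a
`C²` function with nonvanishing differential. -/
def HasC2Boundary {m : ℕ} (K : Set (EuclideanSpace ℝ (Fin m))) : Prop :=
  ∀ q ∈ frontier K, ∃ F : EuclideanSpace ℝ (Fin m) → ℝ,
    ContDiffAt ℝ 2 F q ∧ fderiv ℝ F q ≠ 0 ∧ ∀ᶠ x in nhds q, (x ∈ K ↔ F x ≤ 0)

/-- `κ` is a principal curvature of the boundary of `K` at `q`: an eigenvalue of the Weingarten
map, that is, of the differential at `q` of the outer unit normal field `N` along the boundary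
of `K`, restricted to the tangent hyperplane at `q`. -/
def IsPrincipalCurvature {m : ℕ} (K : Set (EuclideanSpace ℝ (Fin m)))
    (q : EuclideanSpace ℝ (Fin m)) (κ : ℝ) : Prop :=
  q ∈ frontier K ∧
    ∃ (N : EuclideanSpace ℝ (Fin m) → EuclideanSpace ℝ (Fin m))
      (A : EuclideanSpace ℝ (Fin m) →L[ℝ] EuclideanSpace ℝ (Fin m))
      (v : EuclideanSpace ℝ (Fin m)),
      (∀ x ∈ frontier K, IsOuterUnitNormal K x (N x)) ∧
      HasFDerivWithinAt N A (frontier K) q ∧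
      v ≠ 0 ∧ inner ℝ v (N q) = 0 ∧ A v = κ • v

/-- `c` is a centre of curvature of `K`: it lies on the inner normal at some boundary point `q`,
at distance `1 / κ` from `q`, where `κ` is a nonzero principal curvature at `q`. -/
def IsCentreOfCurvature {m : ℕ} (K : Set (EuclideanSpace ℝ (Fin m)))
    (c : EuclideanSpace ℝ (Fin m)) : Prop :=
  ∃ (q u : EuclideanSpace ℝ (Fin m)) (κ : ℝ),
    IsPrincipalCurvature K q κ ∧ κ ≠ 0 ∧ IsOuterUnitNormal K q u ∧ c = q - κ⁻¹ • u

/-- `K` is a Euclidean ball (of positive radius). -/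
def IsEuclideanBall {m : ℕ} (K : Set (EuclideanSpace ℝ (Fin m))) : Prop :=
  ∃ (c : EuclideanSpace ℝ (Fin m)) (r : ℝ), 0 < r ∧ K = Metric.closedBall c r

/-- The deformation `C : 𝕊ᵐ⁻¹ × [0, T) → ℝᵐ` of the boundary of `K` that satisfies
`∂C/∂t = N`, where `N` is the outer unit normal of `C`; for each `t`, `Kt t` is the convex body
bounded by the hypersurface `C(𝕊ᵐ⁻¹, t)`. -/
structure IsOuterNormalFlow {m : ℕ} (K : Set (EuclideanSpace ℝ (Fin m))) (T : ℝ)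
    (C : Metric.sphere (0 : EuclideanSpace ℝ (Fin m)) 1 → ℝ → EuclideanSpace ℝ (Fin m))
    (Kt : ℝ → Set (EuclideanSpace ℝ (Fin m))) : Prop where
  /-- `C` is continuous on `𝕊ᵐ⁻¹ × [0, T)`. -/
  continuousOn : ContinuousOn (fun z : Metric.sphere (0 : EuclideanSpace ℝ (Fin m)) 1 × ℝ =>
    C z.1 z.2) (Set.univ ×ˢ Set.Ico 0 T)
  /-- `C(·, 0)` is an embedding of the sphere. -/
  isEmbedding : Topology.IsEmbedding (fun p => C p 0)
  /-- The evolution starts at `K`. -/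
  initial : Kt 0 = K
  /-- `Kt t` is a convex body. -/
  isConvexBody : ∀ t ∈ Set.Ico 0 T, IsConvexBody (Kt t)
  /-- `Kt t` is bounded by `C(𝕊ᵐ⁻¹, t)`. -/
  frontier_eq : ∀ t ∈ Set.Ico 0 T, frontier (Kt t) = Set.range (fun p => C p t)
  /-- At `C(p, t)` there is exactly one outer unit normal, and it is the velocity of `C(p, ·)`. -/
  velocity : ∀ t ∈ Set.Ico 0 T, ∀ p, ∃ N : EuclideanSpace ℝ (Fin m),
    (∀ u, IsOuterUnitNormal (Kt t) (C p t) u ↔ u = N) ∧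
    HasDerivWithinAt (C p) N (Set.Ico 0 T) t

end

/-! The flow produces the outer parallel bodies of `K`: in every direction the support function
grows with unit speed, so `Kt t` is `Metric.cthickening t K` (`IsOuterNormalFlow.eq_cthickening`). A
normal of the parallel body is a normal of `K` prolonged outwards by the length `t`. Hence a point
of `K` keeps its number of normals.

A point of the parallel body outside `K` lies on exactly two normals. One is the outward
prolongation through its nearest point in `K`, which is unique by convexity. The other reaches the
point after crossing `K`; the farthest point of `K` provides one. It is unique because the end point
map `(q, s) ↦ q - s • N q` is a local homeomorphism wherever its value avoids `K`, as the centres of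
curvature lie in `K`. So the points covered at least twice are open and closed in `Kᶜ`, which is
connected for `m ≥ 2`, and some point of `Kᶜ` is covered only once (`multipleFarPoints_eq_empty`).

With `I(K)` the integral of the number of normals, this gives `n(Kt t) = 2 + (I(K) - 2 vol K) / vol
(Kt t)`, and the volume strictly increases. It remains to see that the numerator is positive and
finite when `K` is not a ball. For positivity, the nearest and farthest boundary points give two
normals through every interior point, and some open set of points has a third
(`two_mul_volume_lt_normalIntegral`). For finiteness, the normals are parametrised by a Lipschitz
map on a bounded shell around `K`, and the area inequality applies (`normalIntegral_lt_top`). Balls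
are computed directly, and in dimension one every convex body is a ball. -/

/-! ### Outer normals, nearest points and farthest points -/

theorem IsOuterUnitNormal.mem_frontier {m : ℕ} {K : Set (EuclideanSpace ℝ (Fin m))}
    {q u : EuclideanSpace ℝ (Fin m)} (h : IsOuterUnitNormal K q u) (hq : q ∈ K) :
    q ∈ frontier K := by
  refine ⟨subset_closure hq, fun hi => ?_⟩
  obtain ⟨ε, hε, hb⟩ := Metric.isOpen_iff.1 isOpen_interior q hi
  have h1 : q + (ε / 2) • u ∈ K := by
    apply interior_subset
    apply hb
    rw [Metric.mem_ball, dist_eq_norm, add_sub_cancel_left, norm_smul, h.1, Real.norm_eq_abs,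
      abs_of_pos (by linarith)]
    linarith
  have h2 := h.2 _ h1
  rw [add_sub_cancel_left, inner_smul_left, real_inner_self_eq_norm_sq, h.1] at h2
  simp at h2
  linarith

theorem IsOuterUnitNormal.inner_self {m : ℕ} {K : Set (EuclideanSpace ℝ (Fin m))}
    {q u : EuclideanSpace ℝ (Fin m)} (h : IsOuterUnitNormal K q u) : inner ℝ u u = (1 : ℝ) := by
  rw [real_inner_self_eq_norm_sq, h.1, one_pow]

/-- A point of `K` never lies on the outer part of a normal line. -/
theorem IsOuterUnitNormal.add_smul_notMem {m : ℕ} {K : Set (EuclideanSpace ℝ (Fin m))}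
    {q u : EuclideanSpace ℝ (Fin m)} (h : IsOuterUnitNormal K q u) {s : ℝ} (hs : 0 < s) :
    q + s • u ∉ K := by
  intro h1
  have h2 := h.2 _ h1
  rw [add_sub_cancel_left, inner_smul_left, h.inner_self] at h2
  simp at h2
  linarith

/-- This is uniqueness of the nearest point: adding the two support inequalities, weighted by `s`
and `s'`, gives `‖q' - q‖ ^ 2 ≤ 0`. -/
theorem IsOuterUnitNormal.eq_of_add_smul_eq {m : ℕ} {K : Set (EuclideanSpace ℝ (Fin m))}
    {q u q' u' : EuclideanSpace ℝ (Fin m)} (h : IsOuterUnitNormal K q u) (hq : q ∈ K)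
    (h' : IsOuterUnitNormal K q' u') (hq' : q' ∈ K) {s s' : ℝ} (hs : 0 ≤ s) (hs' : 0 ≤ s')
    (he : q + s • u = q' + s' • u') : q = q' := by
  have h1 := mul_nonpos_of_nonneg_of_nonpos hs (h.2 _ hq')
  have h2 := mul_nonpos_of_nonneg_of_nonpos hs' (h'.2 _ hq)
  have h3 : q' - q = s • u - s' • u' := by
    rw [sub_eq_sub_iff_add_eq_add, ← he, add_comm]
  have h4 : inner ℝ (q' - q) (q' - q) ≤ (0 : ℝ) := by
    nth_rewrite 2 [h3]
    rw [inner_sub_right, inner_smul_right, inner_smul_right]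
    have : inner ℝ (q' - q) u' = -(inner ℝ (q - q') u' : ℝ) := by
      rw [← inner_neg_left, neg_sub]
    rw [this]
    linarith
  rw [real_inner_self_nonpos, sub_eq_zero] at h4
  exact h4.symm

theorem IsOuterUnitNormal.infDist_add_smul {m : ℕ} {K : Set (EuclideanSpace ℝ (Fin m))}
    {q u : EuclideanSpace ℝ (Fin m)} (h : IsOuterUnitNormal K q u) (hq : q ∈ K)
    {s : ℝ} (hs : 0 ≤ s) : Metric.infDist (q + s • u) K = s := by
  apply le_antisymm
  · refine (Metric.infDist_le_dist_of_mem hq).trans ?_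
    rw [dist_eq_norm, add_sub_cancel_left, norm_smul, h.1, mul_one, Real.norm_of_nonneg hs]
  · refine (Metric.le_infDist ⟨q, hq⟩).2 fun y hy => ?_
    have h1 := h.2 y hy
    have h2 : inner ℝ (q + s • u - y) u ≤ ‖q + s • u - y‖ * ‖u‖ := real_inner_le_norm _ _
    rw [h.1, mul_one, ← dist_eq_norm] at h2
    refine le_trans ?_ h2
    have : q + s • u - y = s • u - (y - q) := by abel
    rw [this, inner_sub_left, inner_smul_left, h.inner_self]
    simp
    linarith

theorem exists_eq_add_smul_of_notMem {m : ℕ} {K : Set (EuclideanSpace ℝ (Fin m))}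
    (hconv : Convex ℝ K) (hc : IsCompact K) (hne : K.Nonempty)
    {p : EuclideanSpace ℝ (Fin m)} (hp : p ∉ K) :
    ∃ q ∈ K, ∃ u, IsOuterUnitNormal K q u ∧ ∃ s : ℝ, 0 < s ∧ p = q + s • u := by
  obtain ⟨q, hq, hqi⟩ := exists_norm_eq_iInf_of_complete_convex hne hc.isComplete hconv p
  have h1 := (norm_eq_iInf_iff_real_inner_le_zero hconv hq).1 hqi
  have hs : 0 < ‖p - q‖ := by
    rw [norm_pos_iff, sub_ne_zero]
    rintro rfl
    exact hp hq
  refine ⟨q, hq, ‖p - q‖⁻¹ • (p - q), ⟨?_, fun x hx => ?_⟩, ‖p - q‖, hs, ?_⟩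
  · rw [norm_smul, norm_inv, norm_norm, inv_mul_cancel₀ hs.ne']
  · rw [inner_smul_right, real_inner_comm]
    exact mul_nonpos_of_nonneg_of_nonpos (by positivity) (h1 x hx)
  · rw [smul_smul, mul_inv_cancel₀ hs.ne', one_smul, add_sub_cancel]

theorem isOuterUnitNormal_of_subset_closedBall {m : ℕ} {K : Set (EuclideanSpace ℝ (Fin m))}
    {p q : EuclideanSpace ℝ (Fin m)} (hpq : p ≠ q)
    (hK : K ⊆ Metric.closedBall p ‖q - p‖) :
    IsOuterUnitNormal K q (‖q - p‖⁻¹ • (q - p)) := by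
  have hs : 0 < ‖q - p‖ := by
    rw [norm_pos_iff, sub_ne_zero]
    exact hpq.symm
  refine ⟨?_, fun x hx => ?_⟩
  · rw [norm_smul, norm_inv, norm_norm, inv_mul_cancel₀ hs.ne']
  · rw [inner_smul_right]
    refine mul_nonpos_of_nonneg_of_nonpos (by positivity) ?_
    have h1 : inner ℝ (x - p) (q - p) ≤ ‖x - p‖ * ‖q - p‖ := real_inner_le_norm _ _
    have h2 : ‖x - p‖ ≤ ‖q - p‖ := by simpa [dist_eq_norm] using hK hx
    have h3 : x - q = (x - p) - (q - p) := by abel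
    rw [h3, inner_sub_left, real_inner_self_eq_norm_sq]
    nlinarith

theorem exists_farthest {m : ℕ} {K : Set (EuclideanSpace ℝ (Fin m))}
    (hc : IsCompact K) {p : EuclideanSpace ℝ (Fin m)} (hp : ∃ x ∈ K, x ≠ p) :
    ∃ q ∈ K, ∃ u, IsOuterUnitNormal K q u ∧ ∃ s : ℝ, 0 < s ∧ p = q - s • u ∧
      K ⊆ Metric.closedBall p s := by
  obtain ⟨x, hx, hxp⟩ := hp
  obtain ⟨q, hq, hmax⟩ := hc.exists_isMaxOn ⟨x, hx⟩
    (f := fun y => dist y p) (by fun_prop)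
  have hsub : K ⊆ Metric.closedBall p ‖q - p‖ := fun y hy => by
    simpa [dist_eq_norm] using hmax hy
  have hs : 0 < ‖q - p‖ := by
    have h1 : dist x p ≤ dist q p := hmax hx
    rw [← dist_eq_norm]
    exact (dist_pos.2 hxp).trans_le h1
  have hpq : p ≠ q := by
    rintro rfl
    simp at hs
  refine ⟨q, hq, _, isOuterUnitNormal_of_subset_closedBall hpq hsub, ‖q - p‖, hs, ?_, hsub⟩
  rw [smul_smul, mul_inv_cancel₀ hs.ne', one_smul, sub_sub_cancel]

/-! ### Normals of parallel bodies -/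

/-- The normals of the outer parallel body are those of `K`, started further out. -/
theorem isOuterUnitNormal_cthickening_iff {m : ℕ} {K : Set (EuclideanSpace ℝ (Fin m))}
    (hc : IsCompact K) {t : ℝ} (ht : 0 ≤ t) {x u : EuclideanSpace ℝ (Fin m)} :
    (x ∈ Metric.cthickening t K ∧ IsOuterUnitNormal (Metric.cthickening t K) x u) ↔
      (x - t • u ∈ K ∧ IsOuterUnitNormal K (x - t • u) u) := by
  have hmem : ∀ y, y ∈ Metric.cthickening t K ↔ ∃ k ∈ K, ‖y - k‖ ≤ t := by
    intro y
    rw [hc.cthickening_eq_biUnion_closedBall ht]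
    simp [dist_eq_norm]
  constructor
  · rintro ⟨hx, hu1, hu2⟩
    have hadd : ∀ k ∈ K, k + t • u ∈ Metric.cthickening t K := fun k hk => by
      refine (hmem _).2 ⟨k, hk, ?_⟩
      rw [add_sub_cancel_left, norm_smul, hu1, mul_one, Real.norm_of_nonneg ht]
    obtain ⟨k, hk, hkt⟩ := (hmem x).1 hx
    have huu : inner ℝ u u = (1 : ℝ) := by rw [real_inner_self_eq_norm_sq, hu1, one_pow]
    have h1 := hu2 _ (hadd k hk)
    have h2 : k + t • u - x = t • u - (x - k) := by abel
    rw [h2, inner_sub_left, inner_smul_left, huu] at h1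
    simp only [conj_trivial, mul_one] at h1
    -- The vector `x - k` has length at most `t` but component at least `t` along `u`, so it equals
    -- `t • u`.
    have h3 : ‖(x - k) - t • u‖ ^ 2 ≤ 0 := by
      rw [norm_sub_sq_real, inner_smul_right, norm_smul, hu1, mul_one, Real.norm_of_nonneg ht]
      nlinarith [norm_nonneg (x - k)]
    have h4 : (x - k) - t • u = 0 := by
      rw [← norm_eq_zero]
      exact pow_eq_zero_iff (two_ne_zero) |>.1 (le_antisymm h3 (by positivity))
    have h5 : x - t • u = k := by
      rw [sub_eq_zero] at h4
      rw [← h4, sub_sub_cancel]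
    refine ⟨h5 ▸ hk, hu1, fun y hy => ?_⟩
    have := hu2 _ (hadd y hy)
    rwa [show y + t • u - x = y - (x - t • u) by abel] at this
  · rintro ⟨hx, hu⟩
    refine ⟨(hmem x).2 ⟨_, hx, ?_⟩, hu.1, fun y hy => ?_⟩
    · rw [sub_sub_cancel, norm_smul, hu.1, mul_one, Real.norm_of_nonneg ht]
    · obtain ⟨k, hk, hkt⟩ := (hmem y).1 hy
      have h1 := hu.2 k hk
      have h2 : inner ℝ (y - k) u ≤ ‖y - k‖ * ‖u‖ := real_inner_le_norm _ _
      rw [hu.1, mul_one] at h2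
      have h3 : y - x = (y - k) + (k - (x - t • u)) - t • u := by abel
      rw [h3, inner_sub_left, inner_add_left, inner_smul_left, hu.inner_self]
      simp only [conj_trivial, mul_one]
      linarith

/-- Moving each foot point back by `t • u` shortens the length by `t`, so lengths down to `-t`, that
is, points on the outer half-lines of normals of `K`, are admitted. -/
theorem numNormals_cthickening {m : ℕ} {K : Set (EuclideanSpace ℝ (Fin m))}
    (hc : IsCompact K) {t : ℝ} (ht : 0 ≤ t) (p : EuclideanSpace ℝ (Fin m)) :
    numNormals (Metric.cthickening t K) p =
      Set.encard {ν : EuclideanSpace ℝ (Fin m) × EuclideanSpace ℝ (Fin m) |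
        ν.1 ∈ frontier K ∧ IsOuterUnitNormal K ν.1 ν.2 ∧
          ∃ s : ℝ, -t ≤ s ∧ p = ν.1 - s • ν.2} := by
  rw [numNormals]
  have hinj : Function.Injective
      (fun ν : EuclideanSpace ℝ (Fin m) × EuclideanSpace ℝ (Fin m) => (ν.1 + t • ν.2, ν.2)) := by
    rintro ⟨a, b⟩ ⟨a', b'⟩ h
    simp only [Prod.mk.injEq] at h
    obtain ⟨h1, rfl⟩ := h
    simpa using h1
  conv_rhs => rw [← hinj.encard_image]
  congr 1
  ext ⟨x, u⟩
  simp only [Set.mem_ofPred_eq, Set.mem_image, Prod.mk.injEq, Prod.exists]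
  constructor
  · rintro ⟨hx, hu, s, hs, hp⟩
    have h1 := (isOuterUnitNormal_cthickening_iff hc ht).1
      ⟨Metric.isClosed_cthickening.frontier_subset hx, hu⟩
    refine ⟨x - t • u, u, ⟨h1.2.mem_frontier h1.1, h1.2, s - t, by linarith, ?_⟩, by simp, rfl⟩
    rw [hp, sub_smul]
    abel
  · rintro ⟨q, u', ⟨hq, hu, s, hs, hp⟩, rfl, rfl⟩
    have h1 := (isOuterUnitNormal_cthickening_iff hc ht (x := q + t • u') (u := u')).2
      (by rw [add_sub_cancel_right]; exact ⟨hc.isClosed.frontier_subset hq, hu⟩)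
    refine ⟨h1.2.mem_frontier h1.1, h1.2, s + t, by linarith, ?_⟩
    rw [hp, add_smul]
    abel

theorem numNormals_cthickening_of_mem {m : ℕ} {K : Set (EuclideanSpace ℝ (Fin m))}
    (hc : IsCompact K) {t : ℝ} (ht : 0 ≤ t) {p : EuclideanSpace ℝ (Fin m)} (hp : p ∈ K) :
    numNormals (Metric.cthickening t K) p = numNormals K p := by
  rw [numNormals_cthickening hc ht, numNormals]
  congr 1
  ext ⟨q, u⟩
  simp only [Set.mem_ofPred_eq]
  refine and_congr_right fun hq => and_congr_right fun hu => exists_congr fun s =>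
    and_congr_left fun h => ⟨fun _ => ?_, fun h => by linarith⟩
  by_contra! hs
  refine hu.add_smul_notMem (neg_pos.2 hs) ?_
  rwa [neg_smul, ← sub_eq_add_neg, ← h]

/-- If only one normal of `K` passes through an outer point after leaving `K`, then exactly two
normals of a parallel body pass through this point. -/
theorem numNormals_cthickening_of_notMem {m : ℕ} {K : Set (EuclideanSpace ℝ (Fin m))}
    (hconv : Convex ℝ K) (hc : IsCompact K) (hne : K.Nontrivial) {t : ℝ} (ht : 0 ≤ t)
    (huniq : ∀ q ∈ frontier K, ∀ u u', IsOuterUnitNormal K q u → IsOuterUnitNormal K q u' → u = u')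
    {p : EuclideanSpace ℝ (Fin m)} (hp : p ∉ K) (hpt : p ∈ Metric.cthickening t K)
    (hfar : ∀ q ∈ K, ∀ q' ∈ K, ∀ u u' : EuclideanSpace ℝ (Fin m), ∀ s s' : ℝ,
      IsOuterUnitNormal K q u → IsOuterUnitNormal K q' u' → 0 ≤ s → 0 ≤ s' →
      p = q - s • u → p = q' - s' • u' → q = q') :
    numNormals (Metric.cthickening t K) p = 2 := by
  obtain ⟨q, hq, u, hu, s, hs, hps⟩ := exists_eq_add_smul_of_notMem hconv hc hne.nonempty hp
  obtain ⟨q', hq', u', hu', s', hs', hps', -⟩ := exists_farthest hc (hne.exists_ne p)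
  have hst : s ≤ t := by
    have := hu.infDist_add_smul hq hs.le
    rw [← this, ← hps]
    rw [hc.cthickening_eq_biUnion_closedBall ht] at hpt
    obtain ⟨k, hk, hkp⟩ := Set.mem_iUnion₂.1 hpt
    exact (Metric.infDist_le_dist_of_mem hk).trans hkp
  rw [numNormals_cthickening hc ht, Set.encard_eq_two]
  refine ⟨(q, u), (q', u'), ?_, ?_⟩
  · intro h
    obtain ⟨rfl, rfl⟩ := Prod.mk.inj h
    rw [hps] at hps'
    have : (s + s') • u = 0 := by
      rw [add_smul]
      have := congrArg (fun x => x - q + s' • u) hps'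
      simpa using this
    rcases smul_eq_zero.1 this with h | h
    · linarith
    · have := hu.1
      rw [h] at this
      simp at this
  · ext ⟨x, w⟩
    simp only [Set.mem_ofPred_eq, Set.mem_insert_iff, Set.mem_singleton_iff, Prod.mk.injEq]
    constructor
    · rintro ⟨hx, hw, r, hr, hpr⟩
      have hxK := hc.isClosed.frontier_subset hx
      -- The sign of the length separates the two normals: a nonnegative length means that the point
      -- is reached across `K`, a negative one that it lies on the outer half-line from its nearest
      -- point.
      rcases le_or_gt 0 r with h0 | h0
      · right
        obtain rfl := hfar x hxK q' hq' w u' r s' hw hu' h0 hs'.le hpr hps'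
        exact ⟨rfl, huniq _ hx _ _ hw hu'⟩
      · left
        obtain rfl := hw.eq_of_add_smul_eq hxK hu hq (s := -r) (by linarith) hs.le
          (by rw [← hps, hpr, neg_smul, sub_eq_add_neg])
        exact ⟨rfl, huniq _ hx _ _ hw hu⟩
    · rintro (⟨rfl, rfl⟩ | ⟨rfl, rfl⟩)
      · exact ⟨hu.mem_frontier hq, hu, -s, by linarith, by rw [hps, neg_smul, sub_neg_eq_add]⟩
      · exact ⟨hu'.mem_frontier hq', hu', s', by linarith, hps'⟩

/-! ### The `C²` boundary and the end point map of the normals -/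

/-- Near a boundary point, a `C²` boundary is the zero set of a function `F` whose normalized
gradient extends the outer unit normal. -/
theorem HasC2Boundary.exists_local_normal {m : ℕ} {K : Set (EuclideanSpace ℝ (Fin m))}
    (hC2 : HasC2Boundary K) {q : EuclideanSpace ℝ (Fin m)} (hq : q ∈ frontier K) :
    ∃ (F : EuclideanSpace ℝ (Fin m) → ℝ)
      (n : EuclideanSpace ℝ (Fin m) → EuclideanSpace ℝ (Fin m)) (c : ℝ), 0 < c ∧
      ContDiffAt ℝ 1 n q ∧ HasStrictFDerivAt F (c • innerSL ℝ (n q)) q ∧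
      ∀ᶠ x in nhds q, ‖n x‖ = 1 ∧ (x ∈ frontier K ↔ F x = 0) ∧
        (x ∈ frontier K → ∀ u, IsOuterUnitNormal K x u → u = n x) := by
  obtain ⟨F, hF, hF0, hFK⟩ := hC2 q hq
  let L : (EuclideanSpace ℝ (Fin m) →L[ℝ] ℝ) →ₗ[ℝ] EuclideanSpace ℝ (Fin m) :=
    { toFun := fun l => (InnerProductSpace.toDual ℝ _).symm l
      map_add' := fun a b => by simp
      map_smul' := fun a b => by simp }
  let g : EuclideanSpace ℝ (Fin m) → EuclideanSpace ℝ (Fin m) := fun x => L (fderiv ℝ F x)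
  have hgi : ∀ x v, inner ℝ (g x) v = fderiv ℝ F x v := fun x v =>
    InnerProductSpace.toDual_symm_apply
  have hg : ContDiffAt ℝ 1 g q := by
    have h1 : ContDiffAt ℝ 1 (fderiv ℝ F) q := hF.fderiv_right (by norm_num)
    exact (L.toContinuousLinearMap.contDiff (n := 1)).contDiffAt.comp q h1
  have hne : g q ≠ 0 := by
    intro h
    apply hF0
    ext v
    rw [← hgi, h]
    simp
  have hgn : ∀ᶠ x in nhds q, g x ≠ 0 := hg.continuousAt.eventually_ne hne
  have hd : ∀ᶠ x in nhds q, ContDiffAt ℝ 2 F x := hF.eventually (by simp)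
  refine ⟨F, fun x => ‖g x‖⁻¹ • g x, ‖g q‖, norm_pos_iff.2 hne, ?_, ?_, ?_⟩
  · exact ((hg.norm ℝ hne).inv (norm_ne_zero_iff.2 hne)).smul hg
  · have heq : ‖g q‖ • innerSL ℝ (‖g q‖⁻¹ • g q) = fderiv ℝ F q := by
      ext v
      simp only [smul_apply, innerSL_apply_apply, inner_smul_left, hgi]
      rw [smul_eq_mul, conj_trivial, mul_inv_cancel_left₀ (norm_ne_zero_iff.2 hne)]
    rw [heq]
    exact hF.hasStrictFDerivAt (by norm_num)
  · filter_upwards [hgn, hd, hFK.eventually_nhds] with x hx hdx hKx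
    have hnorm : ‖‖g x‖⁻¹ • g x‖ = 1 := by
      rw [norm_smul, norm_inv, norm_norm, inv_mul_cancel₀ (norm_ne_zero_iff.2 hx)]
    have hdiff : DifferentiableAt ℝ F x := hdx.differentiableAt (by norm_num)
    have hfr : x ∈ frontier K ↔ F x = 0 := by
      constructor
      · intro hxf
        rw [frontier_eq_closure_inter_closure] at hxf
        rcases lt_trichotomy (F x) 0 with h | h | h
        · exfalso
          have h1 : ∀ᶠ y in nhds x, y ∈ K := by
            filter_upwards [hKx, hdiff.continuousAt.eventually_lt_const h] with y hy hy'
            exact hy.2 hy'.le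
          obtain ⟨y, hy, hy'⟩ := mem_closure_iff_nhds.1 hxf.2 _ h1
          exact hy' hy
        · exact h
        · exfalso
          have h1 : ∀ᶠ y in nhds x, y ∈ Kᶜ := by
            filter_upwards [hKx, hdiff.continuousAt.eventually_const_lt h] with y hy hy'
            exact fun h => hy'.not_ge (hy.1 h)
          obtain ⟨y, hy, hy'⟩ := mem_closure_iff_nhds.1 hxf.1 _ h1
          exact hy hy'
      · intro h0
        refine ⟨subset_closure (hKx.self_of_nhds.2 h0.le), fun hi => ?_⟩
        -- An interior point of `K` on the zero set would be a local maximum of `F`, contradicting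
        -- the nonvanishing gradient.
        have hmax : IsLocalMax F x := by
          filter_upwards [hKx, mem_interior_iff_mem_nhds.1 hi] with y hy hy'
          rw [h0]
          exact hy.1 hy'
        have h2 := hmax.fderiv_eq_zero
        apply hx
        rw [← inner_self_eq_zero (𝕜 := ℝ), hgi, h2]
        simp
    refine ⟨hnorm, hfr, fun hxf u hu => ?_⟩
    by_contra hne
    have hlt : inner ℝ (‖g x‖⁻¹ • g x) u < (1 : ℝ) :=
      (inner_lt_one_iff_real_of_norm_eq_one hnorm hu.1).2 (Ne.symm hne)
    set w := ‖g x‖⁻¹ • g x with hw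
    have hgw : g x = ‖g x‖ • w := by
      rw [hw, smul_smul, mul_inv_cancel₀ (norm_ne_zero_iff.2 hx), one_smul]
    -- If `u` differed from `w`, the direction `u - w` would lower `F` to first order and so lead
    -- into `K`, although it has positive component along the outer normal `u`.
    have hneg : fderiv ℝ F x (u - w) < 0 := by
      rw [← hgi, hgw, inner_smul_left, inner_sub_right, real_inner_self_eq_norm_sq, hnorm]
      have : 0 < ‖g x‖ := norm_pos_iff.2 hx
      simp only [conj_trivial, one_pow]
      nlinarith
    have hline : HasDerivAt (fun ε : ℝ => x + ε • (u - w)) (u - w) 0 := by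
      simpa using ((hasDerivAt_id (0 : ℝ)).smul_const (u - w)).const_add x
    have hder : HasDerivAt (fun ε : ℝ => F (x + ε • (u - w))) (fderiv ℝ F x (u - w)) 0 :=
      HasFDerivAt.comp_hasDerivAt (f := fun ε : ℝ => x + ε • (u - w)) 0
        (by simpa using hdiff.hasFDerivAt) hline
    have hsgn := eventually_nhdsWithin_sign_eq_of_deriv_neg
      (f := fun ε : ℝ => F (x + ε • (u - w))) (x₀ := 0)
      (by rw [hder.deriv]; exact hneg) (by simpa using hfr.1 hxf)
    have hcont : Filter.Tendsto (fun ε : ℝ => x + ε • (u - w)) (nhds 0) (nhds x) := by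
      simpa using hline.continuousAt.tendsto
    have hev := (hsgn.and (hcont.eventually hKx)).filter_mono
      (nhdsWithin_le_nhds (s := Set.Ioi (0 : ℝ)))
    obtain ⟨ε, ⟨h1, h2⟩, hε⟩ := (hev.and self_mem_nhdsWithin).exists
    have hε : 0 < ε := hε
    have h3 : F (x + ε • (u - w)) < 0 := by
      rw [← sign_eq_neg_one_iff, h1, sign_eq_neg_one_iff]
      linarith
    have h4 := hu.2 _ (h2.2 h3.le)
    rw [add_sub_cancel_left, inner_smul_left, inner_sub_left, hu.inner_self] at h4
    simp only [conj_trivial] at h4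
    nlinarith

theorem HasC2Boundary.normal_unique {m : ℕ} {K : Set (EuclideanSpace ℝ (Fin m))}
    (hC2 : HasC2Boundary K) {q u u' : EuclideanSpace ℝ (Fin m)} (hq : q ∈ frontier K)
    (hu : IsOuterUnitNormal K q u) (hu' : IsOuterUnitNormal K q u') : u = u' := by
  obtain ⟨F, n, c, -, -, -, h⟩ := hC2.exists_local_normal hq
  have := h.self_of_nhds.2.2 hq
  rw [this u hu, this u' hu']

theorem HasC2Boundary.exists_lipschitzOnWith {m : ℕ} {K : Set (EuclideanSpace ℝ (Fin m))}
    (hC2 : HasC2Boundary K) (hc : IsCompact K)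
    {N : EuclideanSpace ℝ (Fin m) → EuclideanSpace ℝ (Fin m)}
    (hN : ∀ x ∈ frontier K, IsOuterUnitNormal K x (N x)) :
    ∃ L, LipschitzOnWith L N (frontier K) := by
  have hfc : IsCompact (frontier K) := hc.of_isClosed_subset isClosed_frontier
    hc.isClosed.frontier_subset
  refine LocallyLipschitzOn.exists_lipschitzOnWith_of_compact hfc fun q hq => ?_
  obtain ⟨F, n, c, -, hn, -, h⟩ := hC2.exists_local_normal hq
  obtain ⟨L, t, ht, hL⟩ := hn.exists_lipschitzOnWith
  refine ⟨L, frontier K ∩ (t ∩ {x | x ∈ frontier K → ∀ u, IsOuterUnitNormal K x u → u = n x}),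
    ?_, ?_⟩
  · exact inter_mem_nhdsWithin _ (Filter.inter_mem ht (h.mono fun x hx => hx.2.2))
  · intro x hx y hy
    rw [hx.2.2 hx.1 _ (hN x hx.1), hy.2.2 hy.1 _ (hN y hy.1)]
    exact hL hx.2.1 hy.2.1

/-- At a point of a normal that is not a centre of curvature, the end point map of the normals is
locally injective and open. -/
theorem HasC2Boundary.endpoint_map_local {m : ℕ} {K : Set (EuclideanSpace ℝ (Fin m))}
    (hC2 : HasC2Boundary K)
    {N : EuclideanSpace ℝ (Fin m) → EuclideanSpace ℝ (Fin m)}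
    (hN : ∀ x ∈ frontier K, IsOuterUnitNormal K x (N x))
    {q : EuclideanSpace ℝ (Fin m)} (hq : q ∈ frontier K) :
    ∃ A : Module.End ℝ (EuclideanSpace ℝ (Fin m)), ∀ s : ℝ, s ≠ 0 →
      (IsPrincipalCurvature K q s⁻¹ → ¬ A.HasEigenvalue s⁻¹) →
      (∃ U ∈ nhds (q, s), ∀ z ∈ U, ∀ w ∈ U, z.1 ∈ frontier K → w.1 ∈ frontier K →
        z.1 - z.2 • N z.1 = w.1 - w.2 • N w.1 → z = w) ∧
      ∀ U ∈ nhds (q, s), ∀ᶠ p in nhds (q - s • N q),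
        ∃ z ∈ U, z.1 ∈ frontier K ∧ p = z.1 - z.2 • N z.1 := by
  obtain ⟨F, n, c, hc, hn, hF, h⟩ := hC2.exists_local_normal hq
  have hNn : ∀ᶠ x in nhds q, x ∈ frontier K → N x = n x :=
    h.mono fun x hx hxf => hx.2.2 hxf _ (hN x hxf)
  have hNq : N q = n q := hNn.self_of_nhds hq
  have hnA : HasStrictFDerivAt n (fderiv ℝ n q) q := hn.hasStrictFDerivAt (by norm_num)
  set A := fderiv ℝ n q with hA
  -- The implication `hcurv` can be met in two ways: `s⁻¹` is not a principal curvature, or `s⁻¹`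
  -- avoids the finite spectrum of the single map `A`, which does not depend on `s`.
  refine ⟨A.toLinearMap, fun s hs hcurv => ?_⟩
  have hAt : ∀ v, inner ℝ (n q) (A v) = (0 : ℝ) := by
    intro v
    have h1 : HasFDerivAt (fun x => ‖n x‖ ^ 2) _ q := hnA.hasFDerivAt.norm_sq
    have h2 : HasFDerivAt (fun x => ‖n x‖ ^ 2)
        (0 : EuclideanSpace ℝ (Fin m) →L[ℝ] ℝ) q := by
      refine (hasFDerivAt_const (1 : ℝ) q).congr_of_eventuallyEq ?_
      filter_upwards [h] with x hx
      rw [hx.1, one_pow]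
    have h3 := congrArg (fun l => l v) (h1.unique h2)
    simpa using h3
  have hAk : ∀ v, inner ℝ (n q) v = (0 : ℝ) → v = s • A v → v = 0 := by
    intro v hv hv'
    by_contra hv0
    have hAv : A v = s⁻¹ • v := by
      nth_rewrite 2 [hv']
      rw [smul_smul, inv_mul_cancel₀ hs, one_smul]
    refine hcurv ⟨hq, N, A, v, hN, ?_, hv0, by rw [hNq, real_inner_comm, hv], hAv⟩
      (Module.End.hasEigenvalue_of_hasEigenvector
        ⟨Module.End.mem_eigenspace_iff.2 hAv, hv0⟩)
    · refine hnA.hasFDerivAt.hasFDerivWithinAt.congr_of_eventuallyEq ?_ hNq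
      exact eventually_nhdsWithin_iff.2 hNn
  -- Adjoining the coordinate `F` replaces charts of the hypersurface: `G` maps between spaces of
  -- equal dimension, and the boundary is the slice where the last coordinate vanishes.
  let G : EuclideanSpace ℝ (Fin m) × ℝ → EuclideanSpace ℝ (Fin m) × ℝ :=
    fun z => (z.1 - z.2 • n z.1, F z.1)
  have hG : ∃ G' : EuclideanSpace ℝ (Fin m) × ℝ →L[ℝ] EuclideanSpace ℝ (Fin m) × ℝ,
      HasStrictFDerivAt G G' (q, s) ∧
      ∀ z, G' z = (z.1 - (s • A z.1 + z.2 • n q), c * inner ℝ (n q) z.1) := by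
    have h1 : HasStrictFDerivAt (fun z : EuclideanSpace ℝ (Fin m) × ℝ => z.1)
      (ContinuousLinearMap.fst ℝ _ ℝ) (q, s) := hasStrictFDerivAt_fst
    have h2 : HasStrictFDerivAt (fun z : EuclideanSpace ℝ (Fin m) × ℝ => z.2)
      (ContinuousLinearMap.snd ℝ _ ℝ) (q, s) := hasStrictFDerivAt_snd
    have h3 : HasStrictFDerivAt (fun z : EuclideanSpace ℝ (Fin m) × ℝ => n z.1) _ (q, s) :=
      HasStrictFDerivAt.comp (q, s) (g := n) hnA h1
    have h4 : HasStrictFDerivAt (fun z : EuclideanSpace ℝ (Fin m) × ℝ => F z.1) _ (q, s) :=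
      HasStrictFDerivAt.comp (q, s) (g := F) hF h1
    refine ⟨_, (h1.sub (h2.smul h3)).prodMk h4, fun z => ?_⟩
    simp
  obtain ⟨G', hG, hG'⟩ := hG
  have hinj : Function.Injective G'.toLinearMap := by
    rw [injective_iff_map_eq_zero]
    rintro ⟨v, σ⟩ hz
    rw [ContinuousLinearMap.coe_coe, hG', Prod.mk_eq_zero] at hz
    obtain ⟨hz1, hz2⟩ := hz
    simp only at hz1 hz2
    have hv : inner ℝ (n q) v = (0 : ℝ) := (mul_eq_zero.1 hz2).resolve_left hc.ne'
    -- The normal component isolates `σ`, since `v` and `A v` are tangential; the tangential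
    -- remainder `v = s • A v` is excluded by `hAk`.
    have h1 := congrArg (fun x => (inner ℝ (n q) x : ℝ)) hz1
    simp only [inner_sub_right, inner_add_right, inner_smul_right, hv, hAt,
      real_inner_self_eq_norm_sq, h.self_of_nhds.1, inner_zero_right] at h1
    have hσ : σ = 0 := by linarith
    subst hσ
    rw [zero_smul, add_zero, sub_eq_zero] at hz1
    rw [hAk v hv hz1]
    rfl
  let e : (EuclideanSpace ℝ (Fin m) × ℝ) ≃L[ℝ] (EuclideanSpace ℝ (Fin m) × ℝ) :=
    (LinearEquiv.ofInjectiveEndo G'.toLinearMap hinj).toContinuousLinearEquiv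
  have he : (e : EuclideanSpace ℝ (Fin m) × ℝ →L[ℝ] EuclideanSpace ℝ (Fin m) × ℝ) = G' :=
    ContinuousLinearMap.ext fun z => rfl
  rw [← he] at hG
  have hfst : Filter.Tendsto (fun z : EuclideanSpace ℝ (Fin m) × ℝ => z.1) (nhds (q, s))
    (nhds q) := continuous_fst.tendsto _
  have hgood : ∀ᶠ z : EuclideanSpace ℝ (Fin m) × ℝ in nhds (q, s),
      (z.1 ∈ frontier K ↔ F z.1 = 0) ∧ (z.1 ∈ frontier K → N z.1 = n z.1) :=
    hfst.eventually (p := fun x => (x ∈ frontier K ↔ F x = 0) ∧ (x ∈ frontier K → N x = n x))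
      (h.mono fun x hx => ⟨hx.2.1, fun hxf => hx.2.2 hxf _ (hN x hxf)⟩)
  constructor
  · refine ⟨_, Filter.inter_mem (hG.toOpenPartialHomeomorph.open_source.mem_nhds
      hG.mem_toOpenPartialHomeomorph_source) hgood, ?_⟩
    intro z hz w hw hzf hwf hzw
    apply hG.toOpenPartialHomeomorph.injOn hz.1 hw.1
    rw [hG.toOpenPartialHomeomorph_coe]
    simp only [G]
    rw [← hz.2.2 hzf, ← hw.2.2 hwf, hzw, hz.2.1.1 hzf, hw.2.1.1 hwf]
  · intro U hU
    have h1 : G '' (U ∩ {z | (z.1 ∈ frontier K ↔ F z.1 = 0) ∧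
        (z.1 ∈ frontier K → N z.1 = n z.1)}) ∈ nhds (G (q, s)) := by
      rw [← hG.map_nhds_eq_of_equiv]
      exact Filter.image_mem_map (Filter.inter_mem hU hgood)
    have h2 : G (q, s) = (q - s • N q, 0) := by
      simp only [G]
      rw [hNq, h.self_of_nhds.2.1.1 hq]
    rw [h2] at h1
    have h3 : Filter.Tendsto (fun p : EuclideanSpace ℝ (Fin m) => (p, (0 : ℝ)))
        (nhds (q - s • N q)) (nhds (q - s • N q, 0)) :=
      (Continuous.prodMk_left (0 : ℝ)).tendsto _
    filter_upwards [h3 h1] with p hp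
    obtain ⟨z, ⟨hzU, hz1, hz2⟩, hz⟩ := hp
    obtain ⟨hza, hzb⟩ := Prod.mk.inj hz
    exact ⟨z, hzU, hz1.2 hzb, by rw [hz2 (hz1.2 hzb)]; exact hza.symm⟩

/-! ### Connectedness of the complement of a bounded convex set -/

/-- The segment runs radially away from `c`; were one of its points in `K`, convexity would put `p`
in `K` as well. -/
theorem exists_segment_subset_compl {E : Type*} [NormedAddCommGroup E] [NormedSpace ℝ E]
    {K : Set E} (hconv : Convex ℝ K) {c : E} (hcK : c ∈ K) {p : E} (hp : p ∉ K) {r : ℝ}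
    (hr : dist p c ≤ r) : ∃ y ∈ Metric.sphere c r, segment ℝ p y ⊆ Kᶜ := by
  have hpc : 0 < ‖p - c‖ := by
    rw [norm_pos_iff, sub_ne_zero]
    rintro rfl
    exact hp hcK
  rw [dist_eq_norm] at hr
  refine ⟨c + (r / ‖p - c‖) • (p - c), ?_, ?_⟩
  · rw [mem_sphere_iff_norm, add_sub_cancel_left, norm_smul, norm_div, norm_norm,
      div_mul_cancel₀ _ hpc.ne', Real.norm_of_nonneg (hpc.le.trans hr)]
  · rintro x ⟨a, b, ha, hb, hab, rfl⟩ hx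
    apply hp
    set l := r / ‖p - c‖
    have hl : 1 ≤ l := (one_le_div hpc).2 hr
    have hμ : 1 ≤ a + b * l := by nlinarith
    have h1 : a • p + b • (c + l • (p - c)) = c + (a + b * l) • (p - c) := by
      have : a = 1 - b := by linarith
      subst this
      module
    rw [h1] at hx
    have h2 := hconv.add_smul_sub_mem hcK hx (t := (a + b * l)⁻¹)
      ⟨by positivity, inv_le_one_of_one_le₀ hμ⟩
    rwa [add_sub_cancel_left, smul_smul, inv_mul_cancel₀ (by positivity), one_smul,
      add_sub_cancel] at h2

theorem Convex.isPreconnected_compl {E : Type*} [NormedAddCommGroup E] [NormedSpace ℝ E]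
    (hE : 1 < Module.rank ℝ E) {K : Set E} (hconv : Convex ℝ K) (hb : Bornology.IsBounded K) :
    IsPreconnected Kᶜ := by
  rcases K.eq_empty_or_nonempty with rfl | ⟨c, hc⟩
  · simpa using isPreconnected_univ
  obtain ⟨R, hR⟩ := hb.subset_ball c
  refine isPreconnected_of_forall_pair fun x hx y hy => ?_
  set r := max R (max (dist x c) (dist y c)) with hr
  obtain ⟨x', hx', hxs⟩ := exists_segment_subset_compl hconv hc hx (r := r) (by simp [hr])
  obtain ⟨y', hy', hys⟩ := exists_segment_subset_compl hconv hc hy (r := r) (by simp [hr])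
  refine ⟨segment ℝ x x' ∪ Metric.sphere c r ∪ segment ℝ y y', ?_, ?_, ?_, ?_⟩
  · refine Set.union_subset (Set.union_subset hxs fun z hz hzK => ?_) hys
    have h1 := hR hzK
    rw [Metric.mem_ball, Metric.mem_sphere.1 hz] at h1
    exact h1.not_ge (le_max_left _ _)
  · exact Or.inl (Or.inl (left_mem_segment ℝ _ _))
  · exact Or.inr (left_mem_segment ℝ _ _)
  · refine IsPreconnected.union y' (Or.inr hy') (right_mem_segment ℝ _ _) ?_
      (convex_segment y y').isPreconnected
    exact IsPreconnected.union x' (right_mem_segment ℝ _ _) hx'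
      (convex_segment x x').isPreconnected (isPreconnected_sphere hE c r)

/-! ### Uniqueness of the far normal outside `K` -/

/-- The points outside of `K` that are reached by two normals after they have left `K`. -/
def multipleFarPoints {m : ℕ} (K : Set (EuclideanSpace ℝ (Fin m)))
    (N : EuclideanSpace ℝ (Fin m) → EuclideanSpace ℝ (Fin m)) :
    Set (EuclideanSpace ℝ (Fin m)) :=
  {p | p ∉ K ∧ ∃ q ∈ frontier K, ∃ q' ∈ frontier K, q ≠ q' ∧ ∃ s s' : ℝ, 0 ≤ s ∧ 0 ≤ s' ∧
    p = q - s • N q ∧ p = q' - s' • N q'}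

section

variable {m : ℕ} {K : Set (EuclideanSpace ℝ (Fin m))}
  {N : EuclideanSpace ℝ (Fin m) → EuclideanSpace ℝ (Fin m)}

theorem endpoint_map_local_of_notMem (hC2 : HasC2Boundary K) (hc : IsCompact K)
    (hcentres : ∀ c, IsCentreOfCurvature K c → c ∈ K)
    (hN : ∀ x ∈ frontier K, IsOuterUnitNormal K x (N x))
    {q : EuclideanSpace ℝ (Fin m)} (hq : q ∈ frontier K) {s : ℝ} (hp : q - s • N q ∉ K) :
    (∃ U ∈ nhds (q, s), ∀ z ∈ U, ∀ w ∈ U, z.1 ∈ frontier K → w.1 ∈ frontier K →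
      z.1 - z.2 • N z.1 = w.1 - w.2 • N w.1 → z = w) ∧
    ∀ U ∈ nhds (q, s), ∀ᶠ p in nhds (q - s • N q),
      ∃ z ∈ U, z.1 ∈ frontier K ∧ p = z.1 - z.2 • N z.1 := by
  obtain ⟨A, hA⟩ := hC2.endpoint_map_local hN hq
  have hs : s ≠ 0 := by
    rintro rfl
    rw [zero_smul, sub_zero] at hp
    exact hp (hc.isClosed.frontier_subset hq)
  refine hA s hs fun hcurv => absurd (hcentres _ ⟨q, N q, s⁻¹, hcurv, inv_ne_zero hs, hN q hq, ?_⟩) hp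
  rw [inv_inv]

theorem isOpen_multipleFarPoints (hC2 : HasC2Boundary K) (hc : IsCompact K)
    (hcentres : ∀ c, IsCentreOfCurvature K c → c ∈ K)
    (hN : ∀ x ∈ frontier K, IsOuterUnitNormal K x (N x)) :
    IsOpen (multipleFarPoints K N) := by
  rw [isOpen_iff_mem_nhds]
  rintro p ⟨hp, q, hq, q', hq', hqq', s, s', hs, hs', h, h'⟩
  have hs : 0 < s := hs.lt_of_ne (by
    rintro rfl
    rw [zero_smul, sub_zero] at h
    exact hp (h ▸ hc.isClosed.frontier_subset hq))
  have hs' : 0 < s' := hs'.lt_of_ne (by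
    rintro rfl
    rw [zero_smul, sub_zero] at h'
    exact hp (h' ▸ hc.isClosed.frontier_subset hq'))
  obtain ⟨V, V', hV, hV', hVV'⟩ := t2_separation_nhds hqq'
  have h1 := (endpoint_map_local_of_notMem hC2 hc hcentres hN hq (h ▸ hp)).2 _
    (prod_mem_nhds hV (Ioi_mem_nhds hs))
  have h2 := (endpoint_map_local_of_notMem hC2 hc hcentres hN hq' (h' ▸ hp)).2 _
    (prod_mem_nhds hV' (Ioi_mem_nhds hs'))
  rw [← h] at h1
  rw [← h'] at h2
  filter_upwards [h1, h2, hc.isClosed.isOpen_compl.mem_nhds hp] with x hx hx' hxK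
  obtain ⟨⟨a, r⟩, ⟨haV, hr⟩, ha, hxa⟩ := hx
  obtain ⟨⟨b, r'⟩, ⟨hbV, hr'⟩, hb, hxb⟩ := hx'
  refine ⟨hxK, a, ha, b, hb, ?_, r, r', le_of_lt hr, le_of_lt hr', hxa, hxb⟩
  exact fun hab => Set.disjoint_left.1 hVV' haV (by rw [show a = b from hab]; exact hbV)

/-- By compactness, pairs of foot points subconverge, and their lengths converge too, being
distances to the end point. If the two limits coincided, local injectivity of the end point map
would fail there. -/
theorem closure_multipleFarPoints_inter_subset (hC2 : HasC2Boundary K) (hc : IsCompact K)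
    (hcentres : ∀ c, IsCentreOfCurvature K c → c ∈ K)
    (hN : ∀ x ∈ frontier K, IsOuterUnitNormal K x (N x)) :
    closure (multipleFarPoints K N) ∩ Kᶜ ⊆ multipleFarPoints K N := by
  rintro p ⟨hpc, hp⟩
  obtain ⟨x, hx, hxp⟩ := mem_closure_iff_seq_limit.1 hpc
  choose hxK q hq q' hq' hqq' s s' hs hs' h h' using hx
  have hfc : IsCompact (frontier K) := hc.of_isClosed_subset isClosed_frontier
    hc.isClosed.frontier_subset
  obtain ⟨⟨a, b⟩, ⟨ha, hb⟩, φ, hφ, hlim⟩ := (hfc.prod hfc).tendsto_subseq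
    (x := fun n => (q n, q' n)) fun n => ⟨hq n, hq' n⟩
  have hNc : ContinuousOn N (frontier K) := by
    obtain ⟨L, hL⟩ := hC2.exists_lipschitzOnWith hc hN
    exact hL.continuousOn
  have hxφ := hxp.comp hφ.tendsto_atTop
  have key : ∀ (r : ℕ → EuclideanSpace ℝ (Fin m)) (σ : ℕ → ℝ) (a : EuclideanSpace ℝ (Fin m)),
      a ∈ frontier K → (∀ n, r n ∈ frontier K) → (∀ n, 0 ≤ σ n) →
      (∀ n, x n = r n - σ n • N (r n)) →
      Filter.Tendsto (fun n => r (φ n)) Filter.atTop (nhds a) →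
      Filter.Tendsto (fun n => σ (φ n)) Filter.atTop (nhds ‖a - p‖) ∧
        p = a - ‖a - p‖ • N a := by
    intro r σ a ha hr hσ hrx hra
    have h1 : ∀ n, σ n = ‖r n - x n‖ := fun n => by
      rw [hrx n, sub_sub_cancel, norm_smul, (hN _ (hr n)).1, mul_one, Real.norm_of_nonneg (hσ n)]
    have h2 : Filter.Tendsto (fun n => σ (φ n)) Filter.atTop (nhds ‖a - p‖) := by
      simp_rw [h1]
      exact (hra.sub hxφ).norm
    refine ⟨h2, ?_⟩
    have h3 : Filter.Tendsto (fun n => N (r (φ n))) Filter.atTop (nhds (N a)) :=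
      (hNc a ha).tendsto.comp (tendsto_nhdsWithin_iff.2
        ⟨hra, Filter.Eventually.of_forall fun n => hr _⟩)
    refine tendsto_nhds_unique hxφ ((hra.sub (h2.smul h3)).congr fun n => ?_)
    exact (hrx _).symm
  have hqa : Filter.Tendsto (fun n => q (φ n)) Filter.atTop (nhds a) :=
    (continuous_fst.tendsto _).comp hlim
  have hqb : Filter.Tendsto (fun n => q' (φ n)) Filter.atTop (nhds b) :=
    (continuous_snd.tendsto _).comp hlim
  obtain ⟨hsa, hpa⟩ := key q s a ha hq hs h hqa
  obtain ⟨hsb, hpb⟩ := key q' s' b hb hq' hs' h' hqb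
  by_cases hab : a = b
  · exfalso
    subst hab
    obtain ⟨U, hU, hinj⟩ := (endpoint_map_local_of_notMem hC2 hc hcentres hN ha (hpa ▸ hp)).1
    have h1 := (hqa.prodMk_nhds hsa).eventually hU
    have h2 := (hqb.prodMk_nhds hsb).eventually hU
    obtain ⟨n, hn1, hn2⟩ := (h1.and h2).exists
    have := hinj _ hn1 _ hn2 (hq _) (hq' _) (by rw [← h, ← h'])
    exact hqq' _ (Prod.mk.inj this).1
  · exact ⟨hp, a, ha, b, hb, hab, _, _, norm_nonneg _, norm_nonneg _, hpa, hpb⟩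

theorem multipleFarPoints_eq_empty (hm : 2 ≤ m) (hconv : Convex ℝ K) (hC2 : HasC2Boundary K)
    (hc : IsCompact K) (hne : K.Nontrivial)
    (hcentres : ∀ c, IsCentreOfCurvature K c → c ∈ K)
    (hN : ∀ x ∈ frontier K, IsOuterUnitNormal K x (N x)) :
    multipleFarPoints K N = ∅ := by
  rw [Set.eq_empty_iff_forall_notMem]
  intro p hp
  have hrank : 1 < Module.rank ℝ (EuclideanSpace ℝ (Fin m)) := by
    rw [← Module.finrank_eq_rank, finrank_euclideanSpace_fin]
    exact_mod_cast hm
  have hsub := (hconv.isPreconnected_compl hrank hc.isBounded).subset_of_closure_inter_subset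
    (isOpen_multipleFarPoints hC2 hc hcentres hN) ⟨p, hp.1, hp⟩
    (closure_multipleFarPoints_inter_subset hC2 hc hcentres hN)
  obtain ⟨q₀, hq₀, u₀, hu₀, R, hR, h0, hK⟩ := exists_farthest hc (hne.exists_ne 0)
  -- Here `q₀ = R • u₀` is farthest from the origin, so the test point is `-(2 * R) • u₀`. For
  -- another foot point `q`, the bound `‖q‖ ≤ R` and the support inequality at `q` give opposing
  -- estimates of `inner ℝ (q - q₀) u₀`; they force `q = q₀` because `3 > 2`.
  have huniq : ∀ q ∈ frontier K, ∀ s : ℝ, 0 ≤ s →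
      q₀ - (3 * R) • u₀ = q - s • N q → q = q₀ := by
    intro q hq s hs he
    have h1 := (hN q hq).2 q₀ hq₀
    have h2 : ‖q‖ ≤ R := by simpa using hK (hc.isClosed.frontier_subset hq)
    have h3 : q₀ = R • u₀ := sub_eq_zero.1 h0.symm
    have h4 : q = (q - q₀) + R • u₀ := by rw [← h3, sub_add_cancel]
    have h5 : ‖q - q₀‖ ^ 2 + 2 * (R * inner ℝ (q - q₀) u₀) ≤ 0 := by
      have h6 : ‖(q - q₀) + R • u₀‖ ^ 2 ≤ R ^ 2 := by
        rw [← h4]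
        gcongr
      rw [norm_add_sq_real, inner_smul_right, norm_smul, hu₀.1, mul_one,
        Real.norm_of_nonneg hR.le] at h6
      linarith
    have h7 : (3 * R) • u₀ = s • N q - (q - q₀) := by
      have := congrArg (fun x => q₀ - x) he
      simp only [sub_sub_cancel] at this
      rw [this]
      abel
    have h8 := congrArg (fun x => (inner ℝ (q - q₀) x : ℝ)) h7
    simp only [inner_smul_right, inner_sub_right (q - q₀) (s • N q),
      real_inner_self_eq_norm_sq] at h8
    have h9 : 0 ≤ s * inner ℝ (q - q₀) (N q) := by
      refine mul_nonneg hs ?_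
      rw [← neg_sub, inner_neg_left]
      linarith
    have h10 : ‖q - q₀‖ ^ 2 ≤ 0 := by nlinarith
    have h11 : ‖q - q₀‖ = 0 := pow_eq_zero_iff two_ne_zero |>.1 (le_antisymm h10 (by positivity))
    exact sub_eq_zero.1 (norm_eq_zero.1 h11)
  have hnot : q₀ - (3 * R) • u₀ ∉ K := by
    intro h
    have h1 := hK h
    have h3 : q₀ = R • u₀ := sub_eq_zero.1 h0.symm
    rw [h3, ← sub_smul, mem_closedBall_zero_iff, norm_smul, hu₀.1, mul_one, Real.norm_eq_abs,
      abs_of_neg (by linarith)] at h1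
    linarith
  obtain ⟨-, q, hq, q', hq', hqq', s, s', hs, hs', he, he'⟩ := hsub hnot
  exact hqq' ((huniq q hq s hs he).trans (huniq q' hq' s' hs' he').symm)

end

/-! ### The area inequality and finiteness of the integral -/

open MeasureTheory

/-- Volume is a constant multiple of the `m`-dimensional Hausdorff measure, for which the Lipschitz
bound is standard. -/
theorem LipschitzOnWith.volume_image_le {m : ℕ} {L : NNReal}
    {f : EuclideanSpace ℝ (Fin m) → EuclideanSpace ℝ (Fin m)}
    {S : Set (EuclideanSpace ℝ (Fin m))} (hf : LipschitzOnWith L f S) :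
    volume (f '' S) ≤ (L : ℝ≥0∞) ^ (m : ℝ) * volume S := by
  have hhaar : (μH[(m : ℝ)] : Measure (EuclideanSpace ℝ (Fin m))).IsAddHaarMeasure := by
    simpa using isAddHaarMeasure_hausdorffMeasure (E := EuclideanSpace ℝ (Fin m))
  rw [Measure.isAddLeftInvariant_eq_smul (volume : Measure (EuclideanSpace ℝ (Fin m)))
    (μH[(m : ℝ)])]
  simp only [Measure.smul_apply]
  rw [mul_smul_comm]
  gcongr
  exact hf.hausdorffMeasure_image_le (by positivity)

theorem eventually_injOn_floor {m : ℕ} (T : Finset (EuclideanSpace ℝ (Fin m))) :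
    ∀ᶠ n : ℕ in Filter.atTop,
      Set.InjOn (fun (x : EuclideanSpace ℝ (Fin m)) (j : Fin m) => ⌊(n : ℝ) * x j⌋) T := by
  have h : ∀ x ∈ T, ∀ y ∈ T, ∀ᶠ n : ℕ in Filter.atTop,
      (fun j : Fin m => ⌊(n : ℝ) * x j⌋) = (fun j : Fin m => ⌊(n : ℝ) * y j⌋) → x = y := by
    intro x _ y _
    by_cases hxy : x = y
    · exact Filter.Eventually.of_forall fun n _ => hxy
    · obtain ⟨j, hj⟩ : ∃ j, x j ≠ y j := by
        by_contra! h
        exact hxy (PiLp.ext h)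
      have hpos : 0 < |x j - y j| := abs_pos.2 (sub_ne_zero.2 hj)
      obtain ⟨n₀, hn₀⟩ := exists_nat_gt (1 / |x j - y j|)
      filter_upwards [Filter.eventually_ge_atTop n₀] with n hn he
      exfalso
      have h1 := Int.abs_sub_lt_one_of_floor_eq_floor (congrFun he j)
      rw [← mul_sub, abs_mul, Nat.abs_cast] at h1
      have h2 : 1 / |x j - y j| < n := hn₀.trans_le (by exact_mod_cast hn)
      rw [div_lt_iff₀ hpos] at h2
      linarith
  have h2 := (Filter.eventually_all_finset T).2 fun x hx => (Filter.eventually_all_finset T).2 (h x hx)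
  filter_upwards [h2] with n hn x hx y hy he
  exact hn x hx y hy he

/-- The area inequality for Lipschitz maps, with multiplicity. -/
theorem LipschitzOnWith.lintegral_encard_fiber_le {m : ℕ} {L : NNReal}
    {f : EuclideanSpace ℝ (Fin m) → EuclideanSpace ℝ (Fin m)}
    {S : Set (EuclideanSpace ℝ (Fin m))} (hS : MeasurableSet S) (hf : LipschitzOnWith L f S) :
    ∫⁻ p, ((S ∩ f ⁻¹' {p}).encard : ℝ≥0∞) ≤ (L : ℝ≥0∞) ^ (m : ℝ) * volume S := by
  let φ : ℕ → EuclideanSpace ℝ (Fin m) → (Fin m → ℤ) := fun n x j => ⌊(n : ℝ) * x j⌋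
  have hφ : ∀ n, Measurable (φ n) := fun n => by
    refine measurable_pi_lambda _ fun j => ?_
    exact Int.measurable_floor.comp (by fun_prop)
  -- `S` is cut into grid cells of side `1 / n`, and `g n p` counts the cells whose image, enlarged
  -- to a measurable hull, contains `p`. Fine grids separate any finite part of a fibre, so the
  -- `liminf` dominates the fibre count and Fatou's lemma applies.
  let A : ℕ → (Fin m → ℤ) → Set (EuclideanSpace ℝ (Fin m)) := fun n i =>
    toMeasurable volume (f '' (S ∩ φ n ⁻¹' {i}))
  let g : ℕ → EuclideanSpace ℝ (Fin m) → ℝ≥0∞ := fun n p => ∑' i, (A n i).indicator 1 p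
  have hgm : ∀ n, Measurable (g n) := fun n =>
    Measurable.tsum fun i => measurable_one.indicator (measurableSet_toMeasurable _ _)
  have hgi : ∀ n, ∫⁻ p, g n p ≤ (L : ℝ≥0∞) ^ (m : ℝ) * volume S := by
    intro n
    have hU : S = ⋃ i, S ∩ φ n ⁻¹' {i} := by
      rw [← Set.inter_iUnion]
      exact (Set.inter_eq_left.2 fun x _ => Set.mem_iUnion.2 ⟨φ n x, rfl⟩).symm
    have hV : volume S = ∑' i, volume (S ∩ φ n ⁻¹' {i}) := by
      conv_lhs => rw [hU]
      refine measure_iUnion (fun i j hij => ?_) fun i => hS.inter (hφ n (measurableSet_singleton i))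
      refine Disjoint.mono Set.inter_subset_right Set.inter_subset_right ?_
      exact Disjoint.preimage _ (by simpa using hij)
    rw [hV, ← ENNReal.tsum_mul_left, lintegral_tsum fun i =>
      (measurable_one.indicator (measurableSet_toMeasurable _ _)).aemeasurable]
    refine ENNReal.tsum_le_tsum fun i => ?_
    rw [lintegral_indicator_one (measurableSet_toMeasurable _ _), measure_toMeasurable]
    exact (hf.mono Set.inter_subset_left).volume_image_le
  have hT : ∀ p, ∀ T : Finset (EuclideanSpace ℝ (Fin m)), (T : Set _) ⊆ S ∩ f ⁻¹' {p} →
      (T.card : ℝ≥0∞) ≤ Filter.liminf (fun n => g n p) Filter.atTop := by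
    intro p T hT
    refine Filter.le_liminf_of_le (by isBoundedDefault) ?_
    filter_upwards [eventually_injOn_floor T] with n hn
    classical
    rw [← Finset.card_image_of_injOn hn]
    refine le_trans ?_ (ENNReal.sum_le_tsum (T.image (φ n)))
    rw [Finset.card_eq_sum_ones, Nat.cast_sum]
    refine Finset.sum_le_sum fun i hi => ?_
    obtain ⟨x, hx, rfl⟩ := Finset.mem_image.1 hi
    have hx' := hT hx
    have : p ∈ A n (φ n x) := subset_toMeasurable _ _ ⟨x, ⟨hx'.1, rfl⟩, hx'.2⟩
    rw [Set.indicator_of_mem this]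
    simp
  have hle : ∀ p, ((S ∩ f ⁻¹' {p}).encard : ℝ≥0∞) ≤
      Filter.liminf (fun n => g n p) Filter.atTop := by
    intro p
    rcases (S ∩ f ⁻¹' {p}).finite_or_infinite with h | h
    · have := hT p h.toFinset (by simp)
      rwa [h.encard_eq_coe_toFinset_card, ENat.toENNReal_coe]
    · by_contra! hlt
      obtain ⟨k, hk⟩ := ENNReal.exists_nat_gt (ne_top_of_lt hlt)
      obtain ⟨T, hTs, hTk⟩ := h.exists_subset_card_eq k
      have := hT p T hTs
      rw [hTk] at this
      exact this.not_gt hk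
  calc ∫⁻ p, ((S ∩ f ⁻¹' {p}).encard : ℝ≥0∞)
      ≤ ∫⁻ p, Filter.liminf (fun n => g n p) Filter.atTop := lintegral_mono hle
    _ ≤ Filter.liminf (fun n => ∫⁻ p, g n p) Filter.atTop := lintegral_liminf_le hgm
    _ ≤ Filter.liminf (fun _ : ℕ => (L : ℝ≥0∞) ^ (m : ℝ) * volume S) Filter.atTop :=
        Filter.liminf_le_liminf (Filter.Eventually.of_forall hgi)
    _ = _ := Filter.liminf_const _

/-- A point of the shell at distance between 1 and 2 from `K` encodes a normal: its projection `P x`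
is the foot point and its distance, rescaled by `D'`, is the length. As `D'` bounds the diameter,
all normals through points of `K` occur. The map `f` to the end point is Lipschitz because `P`,
`infDist` and `N` are. -/
theorem normalIntegral_lt_top {m : ℕ} {K : Set (EuclideanSpace ℝ (Fin m))}
    {N : EuclideanSpace ℝ (Fin m) → EuclideanSpace ℝ (Fin m)}
    (hconv : Convex ℝ K) (hC2 : HasC2Boundary K) (hc : IsCompact K) (hne : K.Nonempty)
    (hN : ∀ x ∈ frontier K, IsOuterUnitNormal K x (N x)) :
    normalIntegral K < ⊤ := by
  have hP : ∀ x, ∃ q, x ∉ K → q ∈ K ∧ ∃ u, IsOuterUnitNormal K q u ∧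
      ∃ s : ℝ, 0 < s ∧ x = q + s • u := fun x => by
    by_cases hx : x ∈ K
    · exact ⟨x, fun h => absurd hx h⟩
    · obtain ⟨q, h⟩ := exists_eq_add_smul_of_notMem hconv hc hne hx
      exact ⟨q, fun _ => h⟩
  choose P hP using hP
  have hPL : ∀ x ∉ K, ∀ y ∉ K, ‖P x - P y‖ ≤ ‖x - y‖ := by
    intro x hx y hy
    obtain ⟨hPx, u, hu, s, hs, hxe⟩ := hP x hx
    obtain ⟨hPy, v, hv, r, hr, hye⟩ := hP y hy
    have h1 := mul_nonpos_of_nonneg_of_nonpos hs.le (hu.2 _ hPy)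
    have h2 := mul_nonpos_of_nonneg_of_nonpos hr.le (hv.2 _ hPx)
    have h3 : inner ℝ (P x - P y) (x - y) ≤ ‖P x - P y‖ * ‖x - y‖ := real_inner_le_norm _ _
    have h4 : x - y = (P x - P y) + s • u - r • v := by
      nth_rewrite 1 [hxe, hye]
      abel
    have h5 : inner ℝ (P x - P y) (x - y) = ‖P x - P y‖ ^ 2 - s * inner ℝ (P y - P x) u
        - r * inner ℝ (P x - P y) v := by
      nth_rewrite 1 [h4]
      rw [inner_sub_right, inner_add_right, inner_smul_right, inner_smul_right,
        real_inner_self_eq_norm_sq, ← neg_sub (P y) (P x), inner_neg_left, norm_neg]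
      ring
    by_contra! hlt
    nlinarith [norm_nonneg (x - y), norm_nonneg (P x - P y)]
  obtain ⟨L, hL⟩ := hC2.exists_lipschitzOnWith hc hN
  obtain ⟨D, hD⟩ := hc.isBounded.subset_closedBall (0 : EuclideanSpace ℝ (Fin m))
  set D' := 2 * max D 1 with hD'
  have hD'pos : 0 < D' := by positivity
  have hdiam : ∀ x ∈ K, ∀ y ∈ K, ‖x - y‖ ≤ D' := fun x hx y hy => by
    have h1 := hD hx
    have h2 := hD hy
    rw [mem_closedBall_zero_iff] at h1 h2
    have := norm_sub_le x y
    have := le_max_left D 1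
    linarith
  let S : Set (EuclideanSpace ℝ (Fin m)) := {x | Metric.infDist x K ∈ Set.Icc (1 : ℝ) 2}
  have hSm : MeasurableSet S := by
    have : IsClosed S := isClosed_Icc.preimage (Metric.continuous_infDist_pt K)
    exact this.measurableSet
  have hSK : ∀ x ∈ S, x ∉ K := fun x hx hxK => by
    have h1 : Metric.infDist x K ∈ Set.Icc (1 : ℝ) 2 := hx
    rw [Metric.infDist_zero_of_mem hxK] at h1
    norm_num at h1
  have hSfin : volume S < ⊤ := by
    have hsub : S ⊆ Metric.cthickening 2 K := by
      rintro x ⟨hx1, hx2⟩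
      rw [Metric.mem_cthickening_iff]
      exact (ENNReal.le_ofReal_iff_toReal_le (Metric.infEDist_ne_top hne) (by norm_num)).2 hx2
    exact (measure_mono hsub).trans_lt hc.cthickening.measure_lt_top
  let f : EuclideanSpace ℝ (Fin m) → EuclideanSpace ℝ (Fin m) := fun x =>
    P x - (D' * (Metric.infDist x K - 1)) • N (P x)
  have hPf : ∀ x ∉ K, P x ∈ frontier K := fun x hx => by
    obtain ⟨hPx, u, hu, -⟩ := hP x hx
    exact hu.mem_frontier hPx
  have hf : LipschitzOnWith (Real.toNNReal (1 + D' + D' * L)) f S := by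
    refine LipschitzOnWith.of_dist_le_mul fun x hx y hy => ?_
    rw [Real.coe_toNNReal _ (by positivity), dist_eq_norm, dist_eq_norm]
    have h1 := hPL x (hSK x hx) y (hSK y hy)
    have h2 : ‖N (P x) - N (P y)‖ ≤ L * ‖x - y‖ := by
      rw [← dist_eq_norm]
      refine (hL.dist_le_mul _ (hPf x (hSK x hx)) _ (hPf y (hSK y hy))).trans ?_
      rw [dist_eq_norm]
      gcongr
    have h3 : |Metric.infDist x K - Metric.infDist y K| ≤ ‖x - y‖ := by
      have := (Metric.lipschitz_infDist_pt K).dist_le_mul x y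
      simpa [Real.dist_eq, dist_eq_norm] using this
    have hy' : Metric.infDist y K ∈ Set.Icc (1 : ℝ) 2 := hy
    have h4 : f x - f y = (P x - P y)
        - ((D' * (Metric.infDist x K - Metric.infDist y K)) • N (P x)
          + (D' * (Metric.infDist y K - 1)) • (N (P x) - N (P y))) := by
      simp only [f]
      module
    rw [h4]
    refine (norm_sub_le _ _).trans ?_
    refine (add_le_add_right (norm_add_le _ _) _).trans ?_
    rw [norm_smul, norm_smul, (hN _ (hPf x (hSK x hx))).1, mul_one, Real.norm_eq_abs,
      Real.norm_eq_abs, abs_mul, abs_of_pos hD'pos, abs_of_nonneg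
        (mul_nonneg hD'pos.le (sub_nonneg.2 hy'.1))]
    have h5 : D' * |Metric.infDist x K - Metric.infDist y K| ≤ D' * ‖x - y‖ := by gcongr
    have h6 : D' * (Metric.infDist y K - 1) * ‖N (P x) - N (P y)‖ ≤ D' * (L * ‖x - y‖) := by
      have : D' * (Metric.infDist y K - 1) ≤ D' := by nlinarith [hy'.2]
      gcongr
    linarith
  have hle : ∀ p ∈ K, (numNormals K p : ℝ≥0∞) ≤ ((S ∩ f ⁻¹' {p}).encard : ℝ≥0∞) := by
    intro p hp
    rw [ENat.toENNReal_le, numNormals]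
    have hval : ∀ ν : EuclideanSpace ℝ (Fin m) × EuclideanSpace ℝ (Fin m),
        ν.1 ∈ frontier K → IsOuterUnitNormal K ν.1 ν.2 →
        P (ν.1 + (1 + ‖p - ν.1‖ / D') • ν.2) = ν.1 ∧
        Metric.infDist (ν.1 + (1 + ‖p - ν.1‖ / D') • ν.2) K = 1 + ‖p - ν.1‖ / D' := by
      intro ν hν hνu
      have hνK := hc.isClosed.frontier_subset hν
      have hpos : 0 < 1 + ‖p - ν.1‖ / D' := by positivity
      obtain ⟨hPx, u, hu, s, hs, he⟩ := hP _ (hνu.add_smul_notMem hpos)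
      exact ⟨(hνu.eq_of_add_smul_eq hνK hu hPx hpos.le hs.le he).symm,
        hνu.infDist_add_smul hνK hpos.le⟩
    refine Set.encard_le_encard_of_injOn
      (f := fun ν => ν.1 + (1 + ‖p - ν.1‖ / D') • ν.2) ?_ ?_
    · rintro ν ⟨hν, hνu, s, hs, hps⟩
      obtain ⟨h1, h2⟩ := hval ν hν hνu
      have hνK := hc.isClosed.frontier_subset hν
      refine ⟨?_, ?_⟩
      · change Metric.infDist _ K ∈ Set.Icc (1 : ℝ) 2
        rw [h2]
        have h3 : ‖p - ν.1‖ / D' ≤ 1 := (div_le_one hD'pos).2 (hdiam _ hp _ hνK)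
        have h4 : 0 ≤ ‖p - ν.1‖ / D' := by positivity
        exact ⟨by linarith, by linarith⟩
      · change f _ = p
        simp only [f]
        rw [h2, h1, add_sub_cancel_left, mul_div_cancel₀ _ hD'pos.ne',
          ← hC2.normal_unique hν hνu (hN _ hν)]
        have h5 : ‖p - ν.1‖ = s := by
          rw [hps, sub_sub_cancel_left, norm_neg, norm_smul, hνu.1, mul_one,
            Real.norm_of_nonneg hs]
        rw [h5, ← hps]
    · rintro ν ⟨hν, hνu, -⟩ ν' ⟨hν', hνu', -⟩ he
      have h1 : ν.1 = ν'.1 := by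
        rw [← (hval ν hν hνu).1, ← (hval ν' hν' hνu').1]
        exact congrArg P he
      refine Prod.ext h1 ?_
      rw [← h1] at hνu'
      exact hC2.normal_unique hν hνu hνu'
  calc normalIntegral K = ∫⁻ p in K, (numNormals K p : ℝ≥0∞) := rfl
    _ ≤ ∫⁻ p in K, ((S ∩ f ⁻¹' {p}).encard : ℝ≥0∞) := setLIntegral_mono' hc.measurableSet hle
    _ ≤ ∫⁻ p, ((S ∩ f ⁻¹' {p}).encard : ℝ≥0∞) := setLIntegral_le_lintegral _ _
    _ ≤ _ := hf.lintegral_encard_fiber_le hSm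
    _ < ⊤ := ENNReal.mul_lt_top (ENNReal.rpow_lt_top_of_nonneg (by positivity)
        ENNReal.coe_ne_top) hSfin

/-! ### Two normals everywhere, three on an open set -/

section

variable {m : ℕ} {K : Set (EuclideanSpace ℝ (Fin m))}
  {N : EuclideanSpace ℝ (Fin m) → EuclideanSpace ℝ (Fin m)}

theorem exists_nearest_normal (hc : IsCompact K)
    (hN : ∀ x ∈ frontier K, IsOuterUnitNormal K x (N x))
    {p : EuclideanSpace ℝ (Fin m)} (hp : p ∈ interior K) (hne : Kᶜ.Nonempty) :
    ∃ q ∈ frontier K, ∃ r : ℝ, 0 < r ∧ Metric.closedBall p r ⊆ K ∧ p = q - r • N q := by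
  obtain ⟨q, hq, hr⟩ := isClosed_closure.exists_infDist_eq_dist hne.closure p
  rw [Metric.infDist_closure] at hr
  have hpos : 0 < dist p q := by
    rw [← hr]
    by_contra! h
    have h1 : p ∈ closure Kᶜ := by
      rw [Metric.mem_closure_iff_infDist_zero hne]
      exact le_antisymm h Metric.infDist_nonneg
    rw [closure_compl] at h1
    exact h1 hp
  have hball : Metric.closedBall p (dist p q) ⊆ K := by
    rw [← closure_ball _ hpos.ne', ← hr]
    exact closure_minimal Metric.ball_infDist_compl_subset hc.isClosed
  have hqK : q ∈ K := hball (by simp [dist_comm])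
  have hqf : q ∈ frontier K := by
    rw [frontier_eq_closure_inter_closure]
    exact ⟨subset_closure hqK, hq⟩
  refine ⟨q, hqf, dist p q, hpos, hball, ?_⟩
  have hu := hN q hqf
  -- The inscribed ball extends by its radius in direction `N q`, so the support inequality at `q`
  -- forces `q - p` to be the radius in that direction.
  have h1 : p + dist p q • N q ∈ K := hball (by
    rw [mem_closedBall_iff_norm, add_sub_cancel_left, norm_smul, hu.1, mul_one,
      Real.norm_of_nonneg hpos.le])
  have h2 := hu.2 _ h1
  have h3 : ‖(q - p) - dist p q • N q‖ ^ 2 ≤ 0 := by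
    rw [norm_sub_sq_real, inner_smul_right, norm_smul, hu.1, mul_one,
      Real.norm_of_nonneg hpos.le, ← dist_eq_norm, dist_comm q p]
    have h4 : p + dist p q • N q - q = dist p q • N q - (q - p) := by abel
    rw [h4, inner_sub_left, inner_smul_left, hu.inner_self] at h2
    simp only [conj_trivial, mul_one] at h2
    nlinarith
  have h5 : (q - p) - dist p q • N q = 0 :=
    norm_eq_zero.1 (pow_eq_zero_iff two_ne_zero |>.1 (le_antisymm h3 (by positivity)))
  rw [sub_eq_zero] at h5
  rw [← h5, sub_sub_cancel]

theorem exists_farthest_normal (hC2 : HasC2Boundary K) (hc : IsCompact K)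
    (hN : ∀ x ∈ frontier K, IsOuterUnitNormal K x (N x))
    {p : EuclideanSpace ℝ (Fin m)} (hne : K.Nontrivial) :
    ∃ q ∈ frontier K, ∃ r : ℝ, 0 < r ∧ K ⊆ Metric.closedBall p r ∧ p = q - r • N q := by
  obtain ⟨q, hq, u, hu, r, hr, hp, hK⟩ := exists_farthest hc (hne.exists_ne p)
  refine ⟨q, hu.mem_frontier hq, r, hr, hK, ?_⟩
  rwa [← hC2.normal_unique (hu.mem_frontier hq) hu (hN _ (hu.mem_frontier hq))]

/-- Normals that reach a point with different lengths are different. -/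
theorem ne_of_length_ne (hN : ∀ x ∈ frontier K, IsOuterUnitNormal K x (N x))
    {p q q' : EuclideanSpace ℝ (Fin m)} (hq : q ∈ frontier K) (hq' : q' ∈ frontier K)
    {r r' : ℝ} (hr : 0 < r) (hr' : 0 < r') (hp : p = q - r • N q) (hp' : p = q' - r' • N q')
    (h : r ≠ r') : (q, N q) ≠ (q', N q') := by
  intro he
  apply h
  have h1 : ‖q - p‖ = r := by
    rw [hp, sub_sub_cancel, norm_smul, (hN q hq).1, mul_one, Real.norm_of_nonneg hr.le]
  have h2 : ‖q' - p‖ = r' := by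
    rw [hp', sub_sub_cancel, norm_smul, (hN q' hq').1, mul_one, Real.norm_of_nonneg hr'.le]
  rw [← h1, ← h2, (Prod.mk.inj he).1]

theorem compl_nonempty_of_isCompact (hm : 1 ≤ m) (hc : IsCompact K) : Kᶜ.Nonempty := by
  have : Nontrivial (EuclideanSpace ℝ (Fin m)) := by
    have : Nonempty (Fin m) := ⟨⟨0, hm⟩⟩
    infer_instance
  have := NormedSpace.noncompactSpace ℝ (EuclideanSpace ℝ (Fin m))
  exact Set.nonempty_compl.2 hc.ne_univ

theorem nontrivial_of_interior_nonempty (hm : 1 ≤ m) (hi : (interior K).Nonempty) :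
    K.Nontrivial := by
  have : Nontrivial (EuclideanSpace ℝ (Fin m)) := by
    have : Nonempty (Fin m) := ⟨⟨0, hm⟩⟩
    infer_instance
  obtain ⟨x, hx⟩ := hi
  obtain ⟨y, hy, hyx⟩ := (mem_closure_iff_nhds.1 (dense_compl_singleton x x)) K
    (mem_interior_iff_mem_nhds.1 hx)
  exact ⟨y, hy, x, interior_subset hx, hyx⟩

theorem two_le_numNormals (hm : 1 ≤ m) (hC2 : HasC2Boundary K) (hc : IsCompact K)
    (hN : ∀ x ∈ frontier K, IsOuterUnitNormal K x (N x)) (hball : ¬ IsEuclideanBall K)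
    {p : EuclideanSpace ℝ (Fin m)} (hp : p ∈ interior K) : 2 ≤ numNormals K p := by
  obtain ⟨q, hq, r, hr, hK, hpq⟩ := exists_nearest_normal hc hN hp
    (compl_nonempty_of_isCompact hm hc)
  obtain ⟨q', hq', r', hr', hK', hpq'⟩ := exists_farthest_normal hC2 hc hN (p := p)
    (nontrivial_of_interior_nonempty hm ⟨p, hp⟩)
  have hne : (q, N q) ≠ (q', N q') := by
    refine ne_of_length_ne hN hq hq' hr hr' hpq hpq' ?_
    rintro rfl
    exact hball ⟨p, r, hr, hK'.antisymm hK⟩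
  rw [← Set.encard_pair hne, numNormals]
  refine Set.encard_le_encard ?_
  rintro ν (rfl | rfl)
  · exact ⟨hq, hN q hq, r, hr.le, hpq⟩
  · exact ⟨hq', hN q' hq', r', hr'.le, hpq'⟩

/-- The two negated inclusions say that `s` lies strictly between the nearest and farthest boundary
distances at the end point. The local openness `hloc` preserves a normal of length near `s` at
nearby points, where it differs in length from the nearest and farthest normals. -/
theorem eventually_three_le_numNormals (hm : 1 ≤ m) (hC2 : HasC2Boundary K) (hc : IsCompact K)
    (hN : ∀ x ∈ frontier K, IsOuterUnitNormal K x (N x))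
    {q : EuclideanSpace ℝ (Fin m)} {s : ℝ} (hs : 0 < s)
    (hloc : ∀ U ∈ nhds (q, s), ∀ᶠ p in nhds (q - s • N q),
      ∃ z ∈ U, z.1 ∈ frontier K ∧ p = z.1 - z.2 • N z.1)
    (hp : q - s • N q ∈ interior K)
    (h1 : ¬ Metric.closedBall (q - s • N q) s ⊆ K)
    (h2 : ¬ K ⊆ Metric.closedBall (q - s • N q) s) :
    ∀ᶠ p in nhds (q - s • N q), 3 ≤ numNormals K p := by
  set p₀ := q - s • N q with hp₀
  obtain ⟨x, hx, hxK⟩ : ∃ x, dist x p₀ < s ∧ x ∉ K := by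
    by_contra! h
    apply h1
    rw [← closure_ball _ hs.ne']
    exact closure_minimal (fun x hx => h x hx) hc.isClosed
  obtain ⟨y, hyK, hy⟩ := Set.not_subset.1 h2
  rw [Metric.mem_closedBall, not_le] at hy
  obtain ⟨a, hxa, has⟩ := exists_between hx
  obtain ⟨b, hsb, hby⟩ := exists_between hy
  have ha : 0 < a := dist_nonneg.trans_lt hxa
  have hU : Set.univ ×ˢ Set.Ioo a b ∈ nhds (q, s) :=
    prod_mem_nhds Filter.univ_mem (Ioo_mem_nhds has hsb)
  have hx' : ∀ᶠ p in nhds p₀, dist x p < a :=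
    (continuous_const.dist continuous_id).continuousAt.eventually_lt_const hxa
  have hy' : ∀ᶠ p in nhds p₀, b < dist y p :=
    (continuous_const.dist continuous_id).continuousAt.eventually_const_lt hby
  filter_upwards [hloc _ hU, hx', hy', isOpen_interior.mem_nhds hp] with p hz hxp hyp hpi
  obtain ⟨⟨q₁, r₁⟩, ⟨-, hra, hrb⟩, hq₁, hpq₁⟩ := hz
  simp only at hra hrb hq₁ hpq₁
  obtain ⟨q₂, hq₂, r₂, hr₂, hK₂, hpq₂⟩ := exists_nearest_normal hc hN hpi
    (compl_nonempty_of_isCompact hm hc)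
  obtain ⟨q₃, hq₃, r₃, hr₃, hK₃, hpq₃⟩ := exists_farthest_normal hC2 hc hN (p := p)
    (nontrivial_of_interior_nonempty hm ⟨p, hpi⟩)
  have h21 : r₂ < r₁ := by
    by_contra! h
    exact hxK (hK₂ (Metric.mem_closedBall.2 (by linarith)))
  have h13 : r₁ < r₃ := by
    have := Metric.mem_closedBall.1 (hK₃ hyK)
    linarith
  have hr₁ : 0 < r₁ := hr₂.trans h21
  have hcard : Set.encard {(q₁, N q₁), (q₂, N q₂), (q₃, N q₃)} = 3 :=
    Set.encard_eq_three.2 ⟨_, _, _,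
      ne_of_length_ne hN hq₁ hq₂ hr₁ hr₂ hpq₁ hpq₂ h21.ne',
      ne_of_length_ne hN hq₁ hq₃ hr₁ hr₃ hpq₁ hpq₃ h13.ne,
      ne_of_length_ne hN hq₂ hq₃ hr₂ hr₃ hpq₂ hpq₃ (h21.trans h13).ne, rfl⟩
  rw [← hcard, numNormals]
  refine Set.encard_le_encard ?_
  rintro ν (rfl | rfl | rfl)
  · exact ⟨hq₁, hN _ hq₁, r₁, hr₁.le, hpq₁⟩
  · exact ⟨hq₂, hN _ hq₂, r₂, hr₂.le, hpq₂⟩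
  · exact ⟨hq₃, hN _ hq₃, r₃, hr₃.le, hpq₃⟩

/-- If `K` is not a ball, then at least three normals pass through the points near a suitable
interior point. -/
theorem exists_eventually_three_le_numNormals (hm : 1 ≤ m) (hconv : Convex ℝ K)
    (hC2 : HasC2Boundary K) (hc : IsCompact K) (hi : (interior K).Nonempty)
    (hN : ∀ x ∈ frontier K, IsOuterUnitNormal K x (N x)) (hball : ¬ IsEuclideanBall K) :
    ∃ p ∈ interior K, ∀ᶠ x in nhds p, 3 ≤ numNormals K x := by
  by_contra hcon
  obtain ⟨c, hcI⟩ := hi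
  obtain ⟨q, hq, ρ, hρ, hρK, hcq⟩ := exists_nearest_normal hc hN hcI
    (compl_nonempty_of_isCompact hm hc)
  set u := N q with hu
  have hu1 : ‖u‖ = 1 := (hN q hq).1
  obtain ⟨A, hA⟩ := hC2.endpoint_map_local hN hq
  let I : Set ℝ := Set.Ioi 0 ∩ (fun s : ℝ => q - s • u) ⁻¹' interior K
  have hIo : IsOpen I := isOpen_Ioi.inter (isOpen_interior.preimage (by fun_prop))
  have hIconv : Convex ℝ I := by
    refine (convex_Ioi 0).inter fun s hs t ht a b ha hb hab => ?_
    have := hconv.interior hs ht ha hb hab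
    change q - (a • s + b • t) • u ∈ interior K
    convert this using 1
    have : a = 1 - b := by linarith
    subst this
    simp only [smul_eq_mul]
    module
  have hρI : ρ ∈ I := ⟨hρ, by change q - ρ • u ∈ interior K; rwa [← hcq]⟩
  let inner : Set ℝ := {s | ∀ b : EuclideanSpace ℝ (Fin m), ‖b‖ ≤ 1 → q - s • u + s • b ∈ K}
  let outer : Set ℝ := {s | ∀ y ∈ K, ‖y - (q - s • u)‖ ≤ s}
  have hinner : IsClosed inner := by
    simp only [inner, Set.ofPred_forall]
    exact isClosed_iInter fun b => isClosed_iInter fun _ => hc.isClosed.preimage (by fun_prop)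
  have houter : IsClosed outer := by
    simp only [outer, Set.ofPred_forall]
    exact isClosed_iInter fun y => isClosed_iInter fun _ =>
      isClosed_le (by fun_prop) continuous_id
  have hmem_inner : ∀ s : ℝ, 0 < s → Metric.closedBall (q - s • u) s ⊆ K → s ∈ inner := by
    intro s hs h b hb
    refine h ?_
    rw [mem_closedBall_iff_norm, add_sub_cancel_left, norm_smul, Real.norm_of_nonneg hs.le]
    nlinarith
  have hinner_mem : ∀ s : ℝ, 0 < s → s ∈ inner → Metric.closedBall (q - s • u) s ⊆ K := by
    intro s hs h x hx
    have h1 := h (s⁻¹ • (x - (q - s • u))) (by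
      rw [norm_smul, norm_inv, Real.norm_of_nonneg hs.le, ← dist_eq_norm]
      exact (inv_mul_le_one₀ hs).2 hx)
    rwa [smul_smul, mul_inv_cancel₀ hs.ne', one_smul, add_sub_cancel] at h1
  have hfin : {s : ℝ | A.HasEigenvalue s⁻¹}.Finite :=
    (A.finite_hasEigenvalue).preimage (inv_injective.injOn)
  -- Without a region of three normals, for generic `s` the ball of radius `s` about `q - s • u`
  -- lies in `K` or contains `K`. Only finitely many `s` are exceptional, and both conditions are
  -- closed.
  have hcover : I ⊆ inner ∪ outer := by
    refine ((hfin.countable.dense_compl ℝ).open_subset_closure_inter hIo).trans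
      (closure_minimal ?_ (hinner.union houter))
    rintro s ⟨⟨hs, hsI⟩, hgen⟩
    have hs : 0 < s := hs
    by_contra h
    refine hcon ⟨_, hsI, eventually_three_le_numNormals hm hC2 hc hN hs
      (hA s hs.ne' fun _ => hgen).2 hsI (fun h' => h (Or.inl (hmem_inner s hs h')))
      fun h' => h (Or.inr fun y hy => ?_)⟩
    rw [← mem_closedBall_iff_norm]
    exact h' hy
  have hdisj : I ∩ (inner ∩ outer) = ∅ := by
    rw [Set.eq_empty_iff_forall_notMem]
    rintro s ⟨⟨hs, -⟩, hsi, hso⟩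
    have hs : 0 < s := hs
    refine hball ⟨q - s • u, s, hs, Set.Subset.antisymm (fun y hy => ?_) (hinner_mem s hs hsi)⟩
    rw [mem_closedBall_iff_norm]
    exact hso y hy
  have hqK := hc.isClosed.frontier_subset hq
  -- Both conditions at once would make `K` a ball, so by connectedness one of them holds on all of
  -- `I`.
  rcases (isPreconnected_iff_subset_of_disjoint_closed.1 hIconv.isPreconnected) inner outer
    hinner houter hcover hdisj with h | h
  · have hbdd : BddAbove I := by
      obtain ⟨D, hD⟩ := hc.isBounded.subset_closedBall q
      refine ⟨D, fun s hs => ?_⟩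
      have h1 := hD (interior_subset hs.2)
      rw [mem_closedBall_iff_norm, sub_sub_cancel_left, norm_neg, norm_smul, hu1, mul_one] at h1
      exact (le_abs_self s).trans h1
    have hsup : 0 < sSup I := hρ.trans_le (le_csSup hbdd hρI)
    -- An inscribed ball of radius `s` touching at `q` reaches depth `2 * s`. Hence `3 / 2 * s` is
    -- still in `I`, beyond the supremum.
    obtain ⟨s, hs, hlt⟩ := exists_lt_of_lt_csSup ⟨ρ, hρI⟩
      (show (2 / 3 : ℝ) * sSup I < sSup I by linarith)
    have hs0 : 0 < s := hs.1
    have h1 : (3 / 2 : ℝ) * s ∈ I := by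
      refine ⟨by change 0 < (3 / 2 : ℝ) * s; positivity, ?_⟩
      refine interior_mono (Metric.ball_subset_closedBall.trans (hinner_mem s hs0 (h hs))) ?_
      rw [Metric.isOpen_ball.interior_eq, mem_ball_iff_norm]
      have : q - ((3 / 2 : ℝ) * s) • u - (q - s • u) = -((1 / 2 * s) • u) := by module
      rw [this, norm_neg, norm_smul, hu1, mul_one, Real.norm_of_nonneg (by positivity)]
      linarith
    have h2 := le_csSup hbdd h1
    linarith
  · obtain ⟨x, hx, hxq⟩ := (nontrivial_of_interior_nonempty hm ⟨c, hcI⟩).exists_ne q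
    have hpos : 0 < ‖x - q‖ := norm_pos_iff.2 (sub_ne_zero.2 hxq)
    -- Small `s` also belong to `I`, but a ball of radius `s` containing `K` would give `‖x - q‖ ≤ 2
    -- * s ≤ ‖x - q‖ / 2`.
    set s := min ρ (‖x - q‖ / 4) with hs
    have hs0 : 0 < s := lt_min hρ (by positivity)
    have hsI : s ∈ I := by
      refine ⟨hs0, ?_⟩
      change q - s • u ∈ interior K
      have h1 := hconv.add_smul_sub_mem_interior hqK hcI (t := s / ρ)
        ⟨by positivity, (div_le_one hρ).2 (min_le_left _ _)⟩
      convert h1 using 1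
      rw [hcq, sub_sub_cancel_left, smul_neg, smul_smul, div_mul_cancel₀ _ hρ.ne', sub_eq_add_neg]
    have h1 := h hsI x hx
    have h2 : ‖x - q‖ ≤ ‖x - (q - s • u)‖ + ‖s • u‖ := by
      have : x - q = (x - (q - s • u)) - s • u := by abel
      rw [this]
      exact norm_sub_le _ _
    rw [norm_smul, hu1, mul_one, Real.norm_of_nonneg hs0.le] at h2
    have h3 : s ≤ ‖x - q‖ / 4 := min_le_right _ _
    linarith

theorem two_mul_volume_lt_normalIntegral (hm : 1 ≤ m) (hconv : Convex ℝ K)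
    (hC2 : HasC2Boundary K) (hc : IsCompact K) (hi : (interior K).Nonempty)
    (hN : ∀ x ∈ frontier K, IsOuterUnitNormal K x (N x)) (hball : ¬ IsEuclideanBall K) :
    2 * volume K < normalIntegral K := by
  obtain ⟨p, hp, h3⟩ := exists_eventually_three_le_numNormals hm hconv hC2 hc hi hN hball
  obtain ⟨V, hV3, hVo, hpV⟩ := eventually_nhds_iff.1 (h3.and (isOpen_interior.mem_nhds hp))
  have hVK : V ⊆ interior K := fun x hx => (hV3 x hx).2
  have hvol : volume (interior K) = volume K := by
    refine le_antisymm (measure_mono interior_subset) ?_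
    calc volume K ≤ volume (interior K ∪ frontier K) := by
          refine measure_mono fun x hx => ?_
          by_cases h : x ∈ interior K
          · exact Or.inl h
          · exact Or.inr ⟨subset_closure hx, h⟩
      _ ≤ volume (interior K) + volume (frontier K) := measure_union_le _ _
      _ = volume (interior K) := by rw [hconv.addHaar_frontier volume, add_zero]
  have hVpos : 0 < volume V := hVo.measure_pos _ ⟨p, hpV⟩
  calc 2 * volume K < 2 * volume K + volume V :=
        ENNReal.lt_add_right (ENNReal.mul_ne_top (by simp) hc.measure_lt_top.ne) hVpos.ne'
    _ = ∫⁻ x in interior K, (2 + V.indicator 1 x) := by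
        rw [lintegral_add_left measurable_const, setLIntegral_const, hvol,
          lintegral_indicator_one hVo.measurableSet, Measure.restrict_apply hVo.measurableSet,
          Set.inter_eq_left.2 hVK]
    _ ≤ ∫⁻ x in interior K, (numNormals K x : ℝ≥0∞) := by
        refine setLIntegral_mono' isOpen_interior.measurableSet fun x hx => ?_
        by_cases hxV : x ∈ V
        · rw [Set.indicator_of_mem hxV]
          have : ((3 : ℕ∞) : ℝ≥0∞) ≤ numNormals K x := ENat.toENNReal_le.2 (hV3 x hxV).1
          refine le_trans (le_of_eq ?_) this
          norm_num
        · rw [Set.indicator_of_notMem hxV, add_zero]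
          have : ((2 : ℕ∞) : ℝ≥0∞) ≤ numNormals K x :=
            ENat.toENNReal_le.2 (two_le_numNormals hm hC2 hc hN hball hx)
          simpa using this
    _ ≤ ∫⁻ x in K, (numNormals K x : ℝ≥0∞) := lintegral_mono_set interior_subset

end

/-! ### The flow consists of parallel bodies -/

open Set Filter in
/-- A function that is touched from below, at each point, by a function of unit slope, has itself
unit slope. -/
theorem eq_add_of_touching_unit_slope {T : ℝ} {h : ℝ → ℝ} (hc : ContinuousOn h (Ico 0 T))
    (htouch : ∀ t ∈ Ico 0 T, ∃ φ : ℝ → ℝ, (∀ s ∈ Ico 0 T, φ s ≤ h s) ∧ φ t = h t ∧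
      HasDerivWithinAt φ 1 (Ico 0 T) t) {b : ℝ} (hb : b ∈ Ico 0 T) : h b = h 0 + b := by
  have hsub : Icc 0 b ⊆ Ico 0 T := fun x hx => ⟨hx.1, hx.2.trans_lt hb.2⟩
  have hslope : ∀ (φ : ℝ → ℝ) (t : ℝ), HasDerivWithinAt φ 1 (Ico 0 T) t →
      Tendsto (slope φ t) (nhdsWithin t (Ico 0 T \ {t})) (nhds 1) := fun φ t hφ =>
    hasDerivWithinAt_iff_tendsto_slope.1 hφ
  apply le_antisymm
  · have key := image_le_of_liminf_slope_right_le_deriv_boundary (a := 0) (b := b)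
      (f := fun τ => -h (b - τ)) (B := fun τ => -h b + τ) (B' := fun _ => 1) ?_ (by simp) ?_ ?_ ?_
      (right_mem_Icc.2 hb.1)
    · simp only [sub_self] at key
      linarith
    · refine (hc.comp (t := Ico 0 T) (by fun_prop) fun x hx => ?_).neg
      exact hsub ⟨by linarith [hx.2], by linarith [hx.1]⟩
    · fun_prop
    · intro x _
      exact ((hasDerivWithinAt_id x _).const_add _)
    · intro x hx r hr
      have hxT : b - x ∈ Ico 0 T := hsub ⟨by linarith [hx.2], by linarith [hx.1]⟩
      obtain ⟨φ, hφ, hφt, hφd⟩ := htouch _ hxT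
      have hmap : Tendsto (fun z => b - z) (nhdsWithin x (Ioi x))
          (nhdsWithin (b - x) (Ico 0 T \ {b - x})) := by
        refine tendsto_nhdsWithin_iff.2 ⟨?_, ?_⟩
        · exact (Continuous.tendsto (by fun_prop) x).mono_left nhdsWithin_le_nhds
        · filter_upwards [Ioo_mem_nhdsGT hx.2] with z hz
          refine ⟨hsub ⟨by linarith [hz.2], by linarith [hz.1, hx.1]⟩, ?_⟩
          simp only [mem_singleton_iff]
          intro he
          linarith [hz.1]
      have hev := ((hslope φ _ hφd).comp hmap).eventually_lt_const hr
      refine Eventually.frequently ?_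
      filter_upwards [hev, Ioo_mem_nhdsGT hx.2] with z hz hzx
      refine lt_of_le_of_lt ?_ hz
      have hzT : b - z ∈ Ico 0 T := hsub ⟨by linarith [hzx.2], by linarith [hzx.1, hx.1]⟩
      have h1 := hφ _ hzT
      have h2 : 0 < z - x := by linarith [hzx.1]
      simp only [Function.comp, slope_def_field]
      rw [hφt, show b - z - (b - x) = -(z - x) by ring, div_neg, ← neg_div]
      apply div_le_div_of_nonneg_right _ h2.le
      linarith
  · have key := image_le_of_liminf_slope_right_le_deriv_boundary (a := 0) (b := b)
      (f := fun τ => -h τ) (B := fun τ => -h 0 + -τ) (B' := fun _ => -1) ?_ (by simp) ?_ ?_ ?_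
      (right_mem_Icc.2 hb.1)
    · linarith
    · exact (hc.mono hsub).neg
    · fun_prop
    · intro x _
      exact ((hasDerivWithinAt_id x _).neg.const_add _)
    · intro x hx r hr
      have hxT : x ∈ Ico 0 T := hsub ⟨hx.1, hx.2.le⟩
      obtain ⟨φ, hφ, hφt, hφd⟩ := htouch _ hxT
      have hmap : nhdsWithin x (Ioi x) ≤ nhdsWithin x (Ico 0 T \ {x}) := by
        refine nhdsWithin_le_iff.2 ?_
        filter_upwards [Ioo_mem_nhdsGT hx.2] with z hz
        refine ⟨hsub ⟨by linarith [hz.1, hx.1], hz.2.le⟩, ?_⟩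
        simp only [mem_singleton_iff]
        intro he
        linarith [hz.1]
      have hev := ((hslope φ _ hφd).mono_left hmap).eventually_const_lt (show -r < 1 by linarith)
      refine Eventually.frequently ?_
      filter_upwards [hev, Ioo_mem_nhdsGT hx.2] with z hz hzx
      have hzT : z ∈ Ico 0 T := hsub ⟨by linarith [hzx.1, hx.1], hzx.2.le⟩
      have h1 := hφ _ hzT
      have h2 : 0 < z - x := by linarith [hzx.1]
      rw [slope_def_field, hφt] at hz
      rw [slope_def_field]
      have h3 : (φ z - h x) / (z - x) ≤ (h z - h x) / (z - x) := by
        apply div_le_div_of_nonneg_right _ h2.le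
        linarith
      have h4 : (-h z - -h x) / (z - x) = -((h z - h x) / (z - x)) := by ring
      rw [h4]
      linarith

section

variable {m : ℕ}

theorem exists_isOuterUnitNormal {A : Set (EuclideanSpace ℝ (Fin m))} (hA : IsCompact A)
    (hne : A.Nonempty) {u : EuclideanSpace ℝ (Fin m)} (hu : ‖u‖ = 1) :
    ∃ y ∈ A, IsOuterUnitNormal A y u := by
  obtain ⟨y, hy, hmax⟩ := hA.exists_isMaxOn hne (f := fun x => (inner ℝ x u : ℝ)) (by fun_prop)
  refine ⟨y, hy, hu, fun x hx => ?_⟩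
  rw [inner_sub_left, sub_nonpos]
  exact hmax hx

/-- Comparison of compact convex sets by their support functions. -/
theorem subset_of_support_le {A B : Set (EuclideanSpace ℝ (Fin m))} (hA : IsCompact A)
    (hB : IsCompact B) (hBconv : Convex ℝ B) (hne : B.Nonempty)
    (h : ∀ u, ∀ y ∈ A, ∀ y' ∈ B, IsOuterUnitNormal A y u → IsOuterUnitNormal B y' u →
      (inner ℝ y u : ℝ) ≤ inner ℝ y' u) : A ⊆ B := by
  intro x hx
  by_contra hxB
  obtain ⟨q, hq, u, hu, s, hs, he⟩ := exists_eq_add_smul_of_notMem hBconv hB hne hxB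
  obtain ⟨y, hy, hyu⟩ := exists_isOuterUnitNormal hA ⟨x, hx⟩ hu.1
  have h1 := hyu.2 x hx
  rw [inner_sub_left] at h1
  have h2 := h u y hy q hq hyu hu
  have h3 : inner ℝ x u = inner ℝ q u + s := by
    rw [he, inner_add_left, inner_smul_left, hu.inner_self]
    simp
  linarith

theorem eq_cthickening_of_support {A K : Set (EuclideanSpace ℝ (Fin m))} (hA : IsCompact A)
    (hAconv : Convex ℝ A) (hAne : A.Nonempty) (hK : IsCompact K) (hKconv : Convex ℝ K)
    (hKne : K.Nonempty) {t : ℝ} (ht : 0 ≤ t)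
    (h : ∀ u, ∀ y ∈ A, ∀ y' ∈ K, IsOuterUnitNormal A y u → IsOuterUnitNormal K y' u →
      (inner ℝ y u : ℝ) = inner ℝ y' u + t) : A = Metric.cthickening t K := by
  have key : ∀ u, ∀ y ∈ A, ∀ y' ∈ Metric.cthickening t K, IsOuterUnitNormal A y u →
      IsOuterUnitNormal (Metric.cthickening t K) y' u → (inner ℝ y u : ℝ) = inner ℝ y' u := by
    intro u y hy y' hy' hu hu'
    obtain ⟨h1, h2⟩ := (isOuterUnitNormal_cthickening_iff hK ht).1 ⟨hy', hu'⟩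
    rw [h u y hy _ h1 hu h2, inner_sub_left, inner_smul_left, hu.inner_self]
    simp
  refine Set.Subset.antisymm ?_ ?_
  · exact subset_of_support_le hA hK.cthickening (hKconv.cthickening t)
      (hKne.mono (Metric.self_subset_cthickening K))
      fun u y hy y' hy' hu hu' => (key u y hy y' hy' hu hu').le
  · exact subset_of_support_le hK.cthickening hA hAconv hAne
      fun u y hy y' hy' hu hu' => (key u y' hy' y hy hu' hu).ge

/-- The flow by the outer unit normal is the family of the outer parallel bodies. -/
theorem IsOuterNormalFlow.eq_cthickening {K : Set (EuclideanSpace ℝ (Fin m))} {T : ℝ}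
    {C : Metric.sphere (0 : EuclideanSpace ℝ (Fin m)) 1 → ℝ → EuclideanSpace ℝ (Fin m)}
    {Kt : ℝ → Set (EuclideanSpace ℝ (Fin m))} (hflow : IsOuterNormalFlow K T C Kt)
    {t : ℝ} (ht : t ∈ Set.Ico 0 T) : Kt t = Metric.cthickening t K := by
  have h0 : (0 : ℝ) ∈ Set.Ico 0 T := ⟨le_rfl, ht.1.trans_lt ht.2⟩
  have hbody := hflow.isConvexBody
  have hK := hflow.initial ▸ hbody 0 h0
  refine eq_cthickening_of_support (hbody t ht).2.1 (hbody t ht).1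
    ((hbody t ht).2.2.mono interior_subset) hK.2.1 hK.1 (hK.2.2.mono interior_subset) ht.1 ?_
  intro u y hy y' hy' hu hu'
  -- This is the support function of `Kt s` in direction `u`, since the maximum is attained on the
  -- boundary.
  set h : ℝ → ℝ := fun s => sSup ((fun p => (inner ℝ (C p s) u : ℝ)) '' Set.univ) with hh
  have hgreat : ∀ s ∈ Set.Ico 0 T, ∀ y ∈ Kt s, IsOuterUnitNormal (Kt s) y u →
      IsGreatest ((fun p => (inner ℝ (C p s) u : ℝ)) '' Set.univ) (inner ℝ y u) := by
    intro s hs y hy hyu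
    constructor
    · have := hyu.mem_frontier hy
      rw [hflow.frontier_eq s hs] at this
      obtain ⟨p, hp⟩ := this
      exact ⟨p, Set.mem_univ p, by simp only [← hp]⟩
    · rintro _ ⟨p, -, rfl⟩
      have hp : C p s ∈ Kt s := by
        apply (hbody s hs).2.1.isClosed.frontier_subset
        rw [hflow.frontier_eq s hs]
        exact ⟨p, rfl⟩
      have := hyu.2 _ hp
      rw [inner_sub_left] at this
      simp only
      linarith
  have hcont : ContinuousOn h (Set.Ico 0 T) := by
    rw [continuousOn_iff_continuous_domRestrict]
    refine isCompact_univ.continuous_sSup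
      (f := fun (s : Set.Ico 0 T) p => (inner ℝ (C p s) u : ℝ)) ?_
    have h1 : Continuous fun z : Set.Ico 0 T × Metric.sphere (0 : EuclideanSpace ℝ (Fin m)) 1 =>
        C z.2 z.1 :=
      hflow.continuousOn.comp_continuous
        (f := fun z : Set.Ico 0 T × Metric.sphere (0 : EuclideanSpace ℝ (Fin m)) 1 =>
          (z.2, (z.1 : ℝ))) (by fun_prop) fun z => ⟨Set.mem_univ _, z.1.2⟩
    exact h1.inner continuous_const
  have hlin := eq_add_of_touching_unit_slope hcont (fun s hs => ?_) ht
  · have h1 := (hgreat t ht y hy hu).csSup_eq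
    have h2 := (hgreat 0 h0 y' (hflow.initial ▸ hy') (hflow.initial ▸ hu')).csSup_eq
    rw [← h1, ← h2]
    exact hlin
  · obtain ⟨z, hz, hzu⟩ := exists_isOuterUnitNormal (hbody s hs).2.1
      ((hbody s hs).2.2.mono interior_subset) hu.1
    have hzf := hzu.mem_frontier hz
    rw [hflow.frontier_eq s hs] at hzf
    obtain ⟨p, rfl⟩ := hzf
    obtain ⟨n, hn, hder⟩ := hflow.velocity s hs p
    obtain rfl := (hn u).1 hzu
    -- The trajectory of a maximising point touches `h` from below. Uniqueness of the normal makes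
    -- its velocity at time `s` equal to `u`, so the slope is `inner ℝ u u = 1`.
    refine ⟨fun r => inner ℝ (C p r) u, fun r hr => ?_, ?_, ?_⟩
    · obtain ⟨w, hw, hwu⟩ := exists_isOuterUnitNormal (hbody r hr).2.1
        ((hbody r hr).2.2.mono interior_subset) hu.1
      have := hgreat r hr w hw hwu
      rw [hh]
      simp only
      rw [this.csSup_eq]
      exact this.2 ⟨p, Set.mem_univ p, rfl⟩
    · exact (hgreat s hs _ hz hzu).csSup_eq.symm
    · have := hder.inner ℝ (hasDerivWithinAt_const s (Set.Ico 0 T) u)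
      simpa [hu.1] using this

end

/-! ### Balls and dimension one -/

section

variable {m : ℕ}

theorem isOuterUnitNormal_closedBall_iff {c q u : EuclideanSpace ℝ (Fin m)} {R : ℝ} (hR : 0 ≤ R) :
    (q ∈ Metric.closedBall c R ∧ IsOuterUnitNormal (Metric.closedBall c R) q u) ↔
      ‖u‖ = 1 ∧ q = c + R • u := by
  rw [← Metric.cthickening_singleton c hR, isOuterUnitNormal_cthickening_iff isCompact_singleton hR,
    Set.mem_singleton_iff, sub_eq_iff_eq_add]
  constructor
  · rintro ⟨h, hu⟩
    exact ⟨hu.1, h⟩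
  · rintro ⟨hu, rfl⟩
    refine ⟨rfl, hu, fun x hx => ?_⟩
    rw [Set.mem_singleton_iff.1 hx, add_sub_cancel_right, sub_self, inner_zero_left]

/-- Both normals lie on the diameter through `p`. The centre is excluded because every normal passes
through it; it is a null set. -/
theorem numNormals_closedBall {c p : EuclideanSpace ℝ (Fin m)} {R : ℝ} (hR : 0 < R)
    (hp : p ∈ Metric.closedBall c R) (hpc : p ≠ c) : numNormals (Metric.closedBall c R) p = 2 := by
  have hr : 0 < ‖p - c‖ := norm_pos_iff.2 (sub_ne_zero.2 hpc)
  have hrR : ‖p - c‖ ≤ R := mem_closedBall_iff_norm.1 hp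
  set r := ‖p - c‖ with hr_def
  set w := r⁻¹ • (p - c) with hw_def
  have hw : ‖w‖ = 1 := by
    rw [hw_def, norm_smul, norm_inv, norm_norm, inv_mul_cancel₀ hr.ne']
  have hrw : p - c = r • w := by
    rw [hw_def, smul_smul, mul_inv_cancel₀ hr.ne', one_smul]
  have hpw : p = c + r • w := by rw [← hrw, add_sub_cancel]
  have hnormal : ∀ u : EuclideanSpace ℝ (Fin m), ‖u‖ = 1 →
      c + R • u ∈ frontier (Metric.closedBall c R) ∧
        IsOuterUnitNormal (Metric.closedBall c R) (c + R • u) u := fun u hu => by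
    have := (isOuterUnitNormal_closedBall_iff (c := c) hR.le).2 ⟨hu, rfl⟩
    exact ⟨this.2.mem_frontier this.1, this.2⟩
  rw [numNormals, Set.encard_eq_two]
  refine ⟨(c + R • w, w), (c + R • -w, -w), ?_, ?_⟩
  · intro h
    have h1 : (2 : ℝ) • w = 0 := by
      rw [two_smul]
      nth_rewrite 1 [(Prod.mk.inj h).2]
      exact neg_add_cancel w
    rw [(smul_eq_zero.1 h1).resolve_left two_ne_zero] at hw
    simp at hw
  · ext ⟨q, u⟩
    simp only [Set.mem_ofPred_eq, Set.mem_insert_iff, Set.mem_singleton_iff, Prod.mk.injEq]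
    constructor
    · rintro ⟨hq, hu, s, hs, hps⟩
      obtain ⟨hu1, rfl⟩ := (isOuterUnitNormal_closedBall_iff hR.le).1
        ⟨Metric.isClosed_closedBall.frontier_subset hq, hu⟩
      have h1 : r • w = (R - s) • u := by
        rw [← hrw, hps]
        module
      have h2 : r = |R - s| := by
        have h3 : ‖r • w‖ = ‖(R - s) • u‖ := congrArg norm h1
        rwa [norm_smul r w, norm_smul (R - s) u, hw, hu1, mul_one, mul_one, Real.norm_of_nonneg hr.le,
          Real.norm_eq_abs] at h3
      rcases abs_choice (R - s) with h | h
      · left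
        rw [← h, ← h2] at h1
        have h3 := smul_right_injective _ hr.ne' h1
        rw [h3]
        exact ⟨rfl, rfl⟩
      · right
        have h4 : R - s = -r := by linarith
        rw [h4, neg_smul, ← smul_neg] at h1
        have h3 : w = -u := smul_right_injective _ hr.ne' h1
        rw [h3, neg_neg]
        exact ⟨rfl, rfl⟩
    · rintro (⟨rfl, rfl⟩ | ⟨rfl, rfl⟩)
      · refine ⟨(hnormal w hw).1, (hnormal w hw).2, R - r, by linarith, ?_⟩
        nth_rewrite 1 [hpw]
        module
      · have hw' : ‖-w‖ = 1 := by rwa [norm_neg]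
        refine ⟨(hnormal _ hw').1, (hnormal _ hw').2, R + r, by linarith, ?_⟩
        nth_rewrite 1 [hpw]
        module

theorem meanNormals_closedBall (hm : 1 ≤ m) (c : EuclideanSpace ℝ (Fin m)) {R : ℝ} (hR : 0 < R) :
    meanNormals (Metric.closedBall c R) = 2 := by
  have : Nontrivial (EuclideanSpace ℝ (Fin m)) := by
    have : Nonempty (Fin m) := ⟨⟨0, hm⟩⟩
    infer_instance
  have hint : normalIntegral (Metric.closedBall c R) = 2 * volume (Metric.closedBall c R) := by
    rw [normalIntegral, ← setLIntegral_const]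
    refine setLIntegral_congr_fun_ae Metric.isClosed_closedBall.measurableSet ?_
    have hne : ∀ᵐ x : EuclideanSpace ℝ (Fin m), x ≠ c := by
      rw [ae_iff]
      simp
    filter_upwards [hne] with x hx hxB
    rw [numNormals_closedBall hR hxB hx]
    norm_num
  rw [meanNormals, hint]
  exact ENNReal.mul_div_cancel_right (Metric.measure_closedBall_pos _ c hR).ne'
    measure_closedBall_lt_top.ne

/-- This disposes of the dimension in which the complement of `K` is disconnected and the covering
argument breaks down. -/
theorem isEuclideanBall_of_dim_one {K : Set (EuclideanSpace ℝ (Fin 1))} (hK : IsConvexBody K) :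
    IsEuclideanBall K := by
  obtain ⟨hconv, hc, hi⟩ := hK
  have hnt := nontrivial_of_interior_nonempty le_rfl hi
  have hcoord : Continuous fun x : EuclideanSpace ℝ (Fin 1) => x 0 := by fun_prop
  obtain ⟨a, ha, hmin⟩ := hc.exists_isMinOn hnt.nonempty hcoord.continuousOn
  obtain ⟨b, hb, hmax⟩ := hc.exists_isMaxOn hnt.nonempty hcoord.continuousOn
  have hext : ∀ x y : EuclideanSpace ℝ (Fin 1), x 0 = y 0 → x = y := fun x y h =>
    PiLp.ext fun i => by rwa [Subsingleton.elim i 0]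
  have hab : a 0 < b 0 := by
    obtain ⟨x, hx, hxa⟩ := hnt.exists_ne a
    have h1 : a 0 ≤ x 0 := hmin hx
    have h2 : x 0 ≤ b 0 := hmax hx
    exact (h1.lt_of_ne fun h => hxa (hext _ _ h.symm)).trans_le h2
  refine ⟨(1 / 2 : ℝ) • (a + b), (b 0 - a 0) / 2, by linarith, ?_⟩
  ext x
  have hd : dist x ((1 / 2 : ℝ) • (a + b)) = |x 0 - (1 / 2) * (a 0 + b 0)| := by
    rw [EuclideanSpace.dist_eq]
    simp [Real.sqrt_sq_eq_abs, Real.dist_eq, mul_add]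
  rw [Metric.mem_closedBall, hd, abs_le]
  constructor
  · intro hx
    have h1 : a 0 ≤ x 0 := hmin hx
    have h2 : x 0 ≤ b 0 := hmax hx
    constructor <;> linarith
  · rintro ⟨h1, h2⟩
    have h3 : 0 < b 0 - a 0 := by linarith
    have h4 := hconv.add_smul_sub_mem ha hb (t := (x 0 - a 0) / (b 0 - a 0))
      ⟨div_nonneg (by linarith) h3.le, (div_le_one h3).2 (by linarith)⟩
    convert h4
    apply hext
    simp [div_mul_cancel₀ _ h3.ne']

/-! ### Growth of the volume and the formula for the mean -/

theorem mem_cthickening_iff_infDist_le {K : Set (EuclideanSpace ℝ (Fin m))} (hne : K.Nonempty)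
    {t : ℝ} (ht : 0 ≤ t) {x : EuclideanSpace ℝ (Fin m)} :
    x ∈ Metric.cthickening t K ↔ Metric.infDist x K ≤ t := by
  rw [Metric.mem_cthickening_iff]
  exact ENNReal.le_ofReal_iff_toReal_le (Metric.infEDist_ne_top hne) ht

theorem volume_cthickening_lt {K : Set (EuclideanSpace ℝ (Fin m))} (hm : 1 ≤ m)
    (hc : IsCompact K) (hne : K.Nonempty) {s t : ℝ} (hs : 0 ≤ s) (hst : s < t) :
    volume (Metric.cthickening s K) < volume (Metric.cthickening t K) := by
  have ht : 0 ≤ t := hs.trans hst.le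
  let V : Set (EuclideanSpace ℝ (Fin m)) := {x | Metric.infDist x K ∈ Set.Ioo s t}
  have hVo : IsOpen V := isOpen_Ioo.preimage (Metric.continuous_infDist_pt K)
  have hVne : V.Nonempty := by
    have : Nontrivial (EuclideanSpace ℝ (Fin m)) := by
      have : Nonempty (Fin m) := ⟨⟨0, hm⟩⟩
      infer_instance
    obtain ⟨u, hu⟩ := exists_norm_eq (EuclideanSpace ℝ (Fin m)) zero_le_one
    obtain ⟨q, hq, hqu⟩ := exists_isOuterUnitNormal hc hne hu
    refine ⟨q + ((s + t) / 2) • u, ?_⟩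
    change Metric.infDist _ K ∈ Set.Ioo s t
    rw [hqu.infDist_add_smul hq (by linarith)]
    constructor <;> linarith
  calc volume (Metric.cthickening s K)
      < volume (Metric.cthickening s K) + volume V :=
        ENNReal.lt_add_right hc.cthickening.measure_lt_top.ne (hVo.measure_pos _ hVne).ne'
    _ = volume (Metric.cthickening s K ∪ V) := by
        refine (measure_union ?_ hVo.measurableSet).symm
        rw [Set.disjoint_left]
        intro x hx hxV
        exact ((mem_cthickening_iff_infDist_le hne hs).1 hx).not_gt hxV.1
    _ ≤ volume (Metric.cthickening t K) := by
        refine measure_mono (Set.union_subset (Metric.cthickening_mono hst.le K) fun x hx => ?_)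
        exact (mem_cthickening_iff_infDist_le hne ht).2 hx.2.le

/-- The integral splits into `K`, where the count is unchanged, and the outer layer, where it is 2.
Subtraction in `ℝ≥0∞` is truncated, and `hle` makes it a true difference. -/
theorem meanNormals_cthickening {K : Set (EuclideanSpace ℝ (Fin m))}
    {N : EuclideanSpace ℝ (Fin m) → EuclideanSpace ℝ (Fin m)} (hm : 2 ≤ m)
    (hK : IsConvexBody K) (hC2 : HasC2Boundary K)
    (hcentres : ∀ c, IsCentreOfCurvature K c → c ∈ K)
    (hN : ∀ x ∈ frontier K, IsOuterUnitNormal K x (N x))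
    (hle : 2 * volume K ≤ normalIntegral K) {t : ℝ} (ht : 0 ≤ t) :
    meanNormals (Metric.cthickening t K) =
      (normalIntegral K - 2 * volume K) / volume (Metric.cthickening t K) + 2 := by
  obtain ⟨hconv, hc, hi⟩ := hK
  have hnt := nontrivial_of_interior_nonempty (by omega) hi
  have hKt := Metric.self_subset_cthickening K (δ := t)
  have hempty := multipleFarPoints_eq_empty hm hconv hC2 hc hnt hcentres hN
  have hout : ∀ p ∈ Metric.cthickening t K \ K, numNormals (Metric.cthickening t K) p = 2 := by
    rintro p ⟨hpt, hp⟩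
    refine numNormals_cthickening_of_notMem hconv hc hnt ht
      (fun q hq u u' hu hu' => hC2.normal_unique hq hu hu') hp hpt ?_
    intro q hq q' hq' u u' s s' hu hu' hs hs' he he'
    by_contra hne
    have hqf := hu.mem_frontier hq
    have hqf' := hu'.mem_frontier hq'
    refine Set.eq_empty_iff_forall_notMem.1 hempty p
      ⟨hp, q, hqf, q', hqf', hne, s, s', hs, hs', ?_, ?_⟩
    · rwa [← hC2.normal_unique hqf hu (hN q hqf)]
    · rwa [← hC2.normal_unique hqf' hu' (hN q' hqf')]
  have hKm := hc.measurableSet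
  have hvol : volume (Metric.cthickening t K) =
      volume K + volume (Metric.cthickening t K \ K) := by
    rw [← measure_union Set.disjoint_sdiff_right (hc.cthickening.measurableSet.diff hKm),
      Set.union_sdiff_cancel hKt]
  have hint : normalIntegral (Metric.cthickening t K) =
      normalIntegral K + 2 * volume (Metric.cthickening t K \ K) := by
    rw [normalIntegral, ← lintegral_inter_add_sdiff _ _ hKm, Set.inter_eq_right.2 hKt,
      ← setLIntegral_const]
    congr 1
    · refine setLIntegral_congr_fun hKm fun p hp => ?_
      simp only [numNormals_cthickening_of_mem hc ht hp]
    · refine setLIntegral_congr_fun (hc.cthickening.measurableSet.diff hKm) fun p hp => ?_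
      simp only [hout p hp]
      norm_num
  have hpos : volume (Metric.cthickening t K) ≠ 0 :=
    ((isOpen_interior.measure_pos volume hi).trans_le
      (measure_mono (interior_subset.trans hKt))).ne'
  have hsum : normalIntegral (Metric.cthickening t K) =
      (normalIntegral K - 2 * volume K) + 2 * volume (Metric.cthickening t K) := by
    rw [hint, hvol, mul_add, ← add_assoc, tsub_add_cancel_of_le hle]
  rw [meanNormals, hsum, ENNReal.add_div,
    ENNReal.mul_div_cancel_right hpos hc.cthickening.measure_lt_top.ne]

end

theorem theorem4 (m : ℕ) (hm : 1 ≤ m) (K : Set (EuclideanSpace ℝ (Fin m)))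
    (hK : IsConvexBody K) (hC2 : HasC2Boundary K)
    (hcentres : ∀ c, IsCentreOfCurvature K c → c ∈ K)
    (T : ℝ) (hT : 0 < T)
    (C : Metric.sphere (0 : EuclideanSpace ℝ (Fin m)) 1 → ℝ → EuclideanSpace ℝ (Fin m))
    (Kt : ℝ → Set (EuclideanSpace ℝ (Fin m)))
    (hflow : IsOuterNormalFlow K T C Kt) :
    (∀ t ∈ Set.Ico 0 T, meanNormals (Kt t) < ⊤) ∧
    (¬ IsEuclideanBall K → StrictAntiOn (fun t => meanNormals (Kt t)) (Set.Ico 0 T)) ∧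
    (IsEuclideanBall K → ∀ t ∈ Set.Ico 0 T, meanNormals (Kt t) = 2) := by
  have hpar : ∀ t ∈ Set.Ico 0 T, Kt t = Metric.cthickening t K :=
    fun t ht => hflow.eq_cthickening ht
  have hballs : IsEuclideanBall K → ∀ t ∈ Set.Ico 0 T, meanNormals (Kt t) = 2 := by
    rintro ⟨c, r, hr, rfl⟩ t ht
    rw [hpar t ht, cthickening_closedBall ht.1 hr.le]
    exact meanNormals_closedBall hm c (by linarith [ht.1])
  by_cases hball : IsEuclideanBall K
  · exact ⟨fun t ht => by rw [hballs hball t ht]; norm_num, fun h => absurd hball h, hballs⟩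
  have hm2 : 2 ≤ m := by
    by_contra! h
    obtain rfl : m = 1 := by omega
    exact hball (isEuclideanBall_of_dim_one hK)
  have hN : ∀ x, ∃ u, x ∈ frontier K → IsOuterUnitNormal K x u := by
    intro x
    by_cases hx : x ∈ frontier K
    · have h0 : (0 : ℝ) ∈ Set.Ico 0 T := ⟨le_rfl, hT⟩
      have hx' := hx
      rw [← hflow.initial, hflow.frontier_eq 0 h0] at hx'
      obtain ⟨p, rfl⟩ := hx'
      obtain ⟨n, hn, -⟩ := hflow.velocity 0 h0 p
      rw [hflow.initial] at hn
      exact ⟨n, fun _ => (hn n).2 rfl⟩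
    · exact ⟨0, fun h => absurd h hx⟩
  choose N hN using hN
  obtain ⟨hconv, hc, hi⟩ := hK
  have hne := hi.mono interior_subset
  have hlt := two_mul_volume_lt_normalIntegral hm hconv hC2 hc hi hN hball
  have hfin := normalIntegral_lt_top hconv hC2 hc hne hN
  have hmean : ∀ t ∈ Set.Ico 0 T, meanNormals (Kt t) =
      (normalIntegral K - 2 * volume K) / volume (Metric.cthickening t K) + 2 := fun t ht => by
    rw [hpar t ht]
    exact meanNormals_cthickening hm2 ⟨hconv, hc, hi⟩ hC2 hcentres hN hlt.le ht.1
  have he0 : normalIntegral K - 2 * volume K ≠ 0 := (tsub_pos_of_lt hlt).ne'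
  have heT : normalIntegral K - 2 * volume K ≠ ⊤ := (tsub_le_self.trans_lt hfin).ne
  have hpos : ∀ t : ℝ, volume (Metric.cthickening t K) ≠ 0 := fun t =>
    ((isOpen_interior.measure_pos volume hi).trans_le
      (measure_mono (interior_subset.trans (Metric.self_subset_cthickening K)))).ne'
  refine ⟨fun t ht => ?_, fun _ s hs t ht hst => ?_, hballs⟩
  · rw [hmean t ht]
    exact ENNReal.add_lt_top.2 ⟨ENNReal.div_lt_top heT (hpos t), by norm_num⟩
  · simp only
    rw [hmean t ht, hmean s hs]
    -- Strictness needs the numerator to be neither zero nor infinite, which are the two bounds on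
    -- `normalIntegral K`.
    refine ENNReal.add_lt_add_right (by norm_num) ?_
    rw [div_eq_mul_inv, div_eq_mul_inv]
    exact ENNReal.mul_lt_mul_right he0 heT
      (ENNReal.inv_lt_inv.2 (volume_cthickening_lt hm hc hne hs.1 hst))
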